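/- Let $p\ge 1$ be an integer and let $r(z)$ be a rational function with complex coefficients such that $r(z)=O(z^{-2})$ as $|z|\to\infty$ and such that no integer is a pole of $r$. Let $S$ be the (finite) set of poles of $r$, let $H_n^{(p)}=\sum_{k=1}^n k^{-p}$ (so $H_0^{(p)}=0$), let $r^{(j)}$ be the $j$-th derivative of $r$, let $\psi=\Gamma'/\Gamma$ be the digamma function and $\psi^{(j)}$ its $j$-th derivative, and let $\gamma$ be the Euler–Mascheroni constant. Here $\zeta$ is the Riemann zeta function, with $\zeta(0)=-\tfrac12$ and with $\zeta(1)$ interpreted as $0$ wherever it occurs. Put $$f(z):=\frac{\pi\cot(\pi z)\,\psi^{(p-1)}(-z)}{(p-1)!}\,r(z),$$ where for $p=1$ the function $\psi(-z)$ is replaced by $\psi(-z)+\gamma$. Then all the infinite series below converge absolutely, and $$\sum_{n=0}^\infty\Big((-1)^p\zeta(p)+H_n^{(p)}\Big)r(n)+(-1)^p\sum_{n=1}^\infty\Big(\zeta(p)-H_{n-1}^{(p)}\Big)r(-n)-2\sum_{k=0}^{\lfloor p/2\rfloor}\frac{\zeta(2k)}{(p-2k)!}\sum_{n=0}^\infty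 r^{(p-2k)}(n)+\sum_{\beta\in S}\operatorname{Res}(f,\beta)=0.$$ -/

import Mathlib

open Filter Topology Asymptotics

noncomputable section

namespace ParametricEuler

/-- The generalized harmonic number `H_n^{(p)} = ∑_{k=1}^n 1 / k^p`, with `H_0^{(p)} = 0`. -/
def genHarmonic (p n : ℕ) : ℂ := ∑ k ∈ Finset.Icc 1 n, 1 / (k : ℂ) ^ p

/-- The Riemann zeta function at natural numbers, with the convention `ζ(1) = 0`
(the value `ζ(0) = -1/2` is `zetaNat_zero` below). -/
def zetaNat (s : ℕ) : ℂ := if s = 1 then 0 else riemannZeta s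

theorem zetaNat_zero : zetaNat 0 = -1 / 2 := by
  simp [zetaNat, riemannZeta_zero]

theorem zetaNat_one : zetaNat 1 = 0 := by
  simp [zetaNat]

/-- The polygamma function `ψ^{(j)}`, the `j`-th derivative of the digamma function `Γ'/Γ`. -/
def polygamma (j : ℕ) (z : ℂ) : ℂ := iteratedDeriv j Complex.digamma z

/-- The function `ψ^{(p-1)}`, where for `p = 1` the function `ψ` is replaced by `ψ + γ`
(the convention that goes with `ζ(1) = 0`). -/
def normPolygamma (p : ℕ) (z : ℂ) : ℂ :=
  if p = 1 then polygamma 0 z + (Real.eulerMascheroniConstant : ℂ) else polygamma (p - 1) z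

/-- The residue at `c` of a function that is holomorphic on a punctured neighbourhood of `c`:
`(2πi)⁻¹ ∮_{|z - c| = R} f(z) dz` for all sufficiently small `R > 0`, written as a limit. -/
def residue (f : ℂ → ℂ) (c : ℂ) : ℂ :=
  limUnder (𝓝[>] (0 : ℝ)) fun R : ℝ => (2 * Real.pi * Complex.I)⁻¹ * ∮ z in C(c, R), f z

/-- The function `ℂ → ℂ` given by a rational function (only its values off the poles matter). -/
def ratEval (r : RatFunc ℂ) (z : ℂ) : ℂ := r.eval (RingHom.id ℂ) z

/-- The poles of a rational function: the zeros of its denominator in lowest terms. -/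
def poles (r : RatFunc ℂ) : Finset ℂ := r.denom.roots.toFinset

/-- `f(z) = π cot(πz) ψ^{(p-1)}(-z) r(z) / (p-1)!`. -/
def kernelFun (p : ℕ) (r : RatFunc ℂ) (z : ℂ) : ℂ :=
  Real.pi * Complex.cot (Real.pi * z) * normPolygamma p (-z) / ((p - 1).factorial : ℂ)
    * ratEval r z

end ParametricEuler

end

noncomputable section

namespace ParametricEuler

/-! ### Residues of functions with finite principal parts -/

/-! The formula is the residue theorem for `kernelFun p r` on the circles of radius `N + 1/2` about
`0`, as `N` tends to infinity.

The integral tends to `0` (`tendsto_circleIntegral_kernelFun`). These circles keep distance at least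
`1/2` from every integer, where the cotangent is bounded (`exists_norm_cot_pi_le`) and the polygamma
factor is `O(√|z|)` (`exists_norm_scaledPolygamma_le`). With `r = O(z⁻²)` the integrand is
`O(|z|^(-3/2))`, which beats the length of the circle.

The residues at the integers are explicit. At `-(n+1)` only the cotangent is singular, with a simple
pole, and the other factors are evaluated there (`hasRes_kernelFun_neg`). At `n ≥ 0` the recurrence
of the polygamma function splits `ψ^{(p-1)}(-z)/(p-1)!` into `(z-n)^(-p)` plus a regular part with
value `(-1)^p ζ(p) + H_n^{(p)}` at `n` (`scaledPolygamma_neg_eq`, `regularPart_self`). Multiplying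
by `π cot(πz) = -2 ∑ ζ(2k) (z-n)^(2k-1)` produces the derivatives of `r` from the singular part and
the harmonic term from the regular part (`hasRes_kernelFun_natCast`). The poles of `r` contribute
residues that are left unevaluated.

All facts about `ψ` come from its partial fraction series (`hasSum_polyTerm`), obtained by
logarithmic differentiation of the Weierstrass product of `1/Γ` and then termwise differentiation.
-/

/-- `f` has at `c` the finite principal part `∑ b_j (z - c)^{-j-1}`, with `b_0 = a`. -/
def HasRes (f : ℂ → ℂ) (c a : ℂ) : Prop :=
  ∃ P : Polynomial ℂ, P.coeff 0 = a ∧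
    (fun z => f z - (z - c)⁻¹ * P.eval (z - c)⁻¹) =O[𝓝[≠] c] (fun _ => (1 : ℂ))

theorem HasRes.congr {f g : ℂ → ℂ} {c a : ℂ} (h : HasRes f c a) (hfg : f =ᶠ[𝓝[≠] c] g) :
    HasRes g c a := by
  obtain ⟨P, hP, hf⟩ := h
  refine ⟨P, hP, hf.congr' ?_ .rfl⟩
  filter_upwards [hfg] with z hz
  rw [hz]

theorem hasRes_of_isBigO_one {f : ℂ → ℂ} {c : ℂ} (h : f =O[𝓝[≠] c] (fun _ => (1 : ℂ))) :
    HasRes f c 0 := ⟨0, by simp, by simpa using h⟩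

theorem HasRes.add {f g : ℂ → ℂ} {c a b : ℂ} (hf : HasRes f c a) (hg : HasRes g c b) :
    HasRes (fun z => f z + g z) c (a + b) := by
  obtain ⟨P, hP, hf⟩ := hf
  obtain ⟨Q, hQ, hg⟩ := hg
  refine ⟨P + Q, by simp [hP, hQ], (hf.add hg).congr_left fun z => ?_⟩
  rw [Polynomial.eval_add]
  ring

theorem HasRes.const_mul {f : ℂ → ℂ} {c a : ℂ} (hf : HasRes f c a) (b : ℂ) :
    HasRes (fun z => b * f z) c (b * a) := by
  obtain ⟨P, hP, hf⟩ := hf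
  refine ⟨Polynomial.C b * P, by simp [hP], (hf.const_mul_left b).congr_left fun z => ?_⟩
  rw [Polynomial.eval_mul, Polynomial.eval_C]
  ring

theorem HasRes.sum {ι : Type*} {f : ι → ℂ → ℂ} {c : ℂ} {a : ι → ℂ} (s : Finset ι)
    (h : ∀ i ∈ s, HasRes (f i) c (a i)) :
    HasRes (fun z => ∑ i ∈ s, f i z) c (∑ i ∈ s, a i) := by
  classical
  induction s using Finset.induction_on with
  | empty => simpa using hasRes_of_isBigO_one (isBigO_zero _ _)
  | insert i s hi ih =>
    simp only [Finset.sum_insert hi]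
    exact (h i (by simp)).add (ih fun j hj => h j (by simp [hj]))

/-- The Taylor remainder of `g` after degree `n` is `O((z-c)^(n+1))` and cancels the pole. The
Taylor polynomial, read backwards, is the principal part, so its top coefficient becomes the
residue. -/
theorem hasRes_inv_pow_mul {g : ℂ → ℂ} {c : ℂ} (hg : AnalyticAt ℂ g c) (n : ℕ) :
    HasRes (fun z => (z - c)⁻¹ ^ (n + 1) * g z) c (iteratedDeriv n g c / n.factorial) := by
  set b : ℕ → ℂ := fun i => iteratedDeriv i g c / i.factorial with hb
  have h1 : (fun z => g z - ∑ i ∈ Finset.range (n + 1), b i * (z - c) ^ i)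
      =O[𝓝 c] fun z => (z - c) ^ (n + 1) := by
    have h := hg.hasFPowerSeriesAt.isBigO_sub_partialSum_pow (n + 1)
    have ht : Tendsto (fun z => z - c) (𝓝 c) (𝓝 0) := by
      simpa using (tendsto_id (x := 𝓝 c)).sub_const c
    have h2 := h.comp_tendsto ht
    refine (h2.congr_left fun z => ?_).trans (IsBigO.of_norm_right ?_)
    · simp [FormalMultilinearSeries.partialSum, hb, mul_comm, smul_eq_mul]
    · refine (isBigO_refl _ _).congr_left fun z => by simp
  refine ⟨∑ i ∈ Finset.range (n + 1), Polynomial.C (b i) * Polynomial.X ^ (n - i), ?_, ?_⟩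
  · rw [Polynomial.finsetSum_coeff, Finset.sum_eq_single n]
    · simp [hb]
    · intro i hi hin
      have : 0 ≠ n - i := by simp at hi; omega
      simp [Polynomial.coeff_X_pow, this]
    · simp
  · have h2 := (isBigO_refl (fun z => (z - c)⁻¹ ^ (n + 1)) (𝓝[≠] c)).mul
      (h1.mono nhdsWithin_le_nhds)
    refine h2.congr' ?_ ?_
    · filter_upwards [self_mem_nhdsWithin] with z hz
      have hz' : z - c ≠ 0 := sub_ne_zero.2 hz
      rw [mul_sub, Polynomial.eval_finsetSum, Finset.mul_sum, Finset.mul_sum]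
      congr 1
      refine Finset.sum_congr rfl fun i hi => ?_
      have hi' : i ≤ n := by simp at hi; omega
      obtain ⟨k, rfl⟩ := Nat.exists_eq_add_of_le hi'
      simp only [Polynomial.eval_mul, Polynomial.eval_C, Polynomial.eval_pow, Polynomial.eval_X,
        Nat.add_sub_cancel_left, inv_pow]
      field_simp
      ring
    · filter_upwards [self_mem_nhdsWithin] with z hz
      have hz' : z - c ≠ 0 := sub_ne_zero.2 hz
      rw [← mul_pow, inv_mul_cancel₀ hz', one_pow]

theorem MeromorphicAt.exists_hasRes {f : ℂ → ℂ} {c : ℂ} (hf : MeromorphicAt f c) :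
    ∃ a, HasRes f c a := by
  obtain ⟨n, hn⟩ := hf
  refine ⟨_, (hasRes_inv_pow_mul (g := fun z => (z - c) ^ (n + 1) • f z) ?_ n).congr ?_⟩
  · have : (fun z => (z - c) ^ (n + 1) • f z) = fun z => (z - c) * ((z - c) ^ n • f z) := by
      ext z; simp only [smul_eq_mul]; ring
    rw [this]
    exact (analyticAt_id.sub analyticAt_const).mul hn
  · filter_upwards [self_mem_nhdsWithin] with z hz
    have hz' : z - c ≠ 0 := sub_ne_zero.2 hz
    rw [smul_eq_mul, ← mul_assoc, ← mul_pow, inv_mul_cancel₀ hz', one_pow, one_mul]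

/-- Among the negative powers only `(z-c)⁻¹` lacks a primitive. The circle need not be centred at
`c`, as one large circle must serve all poles at once. -/
theorem circleIntegral_principalPart (P : Polynomial ℂ) {c x : ℂ} {R : ℝ}
    (hc : c ∈ Metric.ball x R) :
    (∮ z in C(x, R), (z - c)⁻¹ * P.eval (z - c)⁻¹) = 2 * Real.pi * Complex.I * P.coeff 0 := by
  have hR : 0 < R := Metric.pos_of_mem_ball hc
  have hci : ∀ n : ℤ, CircleIntegrable (fun z => (z - c) ^ n) x R := fun n => by
    rw [circleIntegrable_sub_zpow_iff]
    refine Or.inr (Or.inr fun h => ?_)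
    rw [abs_of_pos hR] at h
    exact (Metric.mem_ball.1 hc).ne (Metric.mem_sphere.1 h)
  have h1 : ∀ z : ℂ, (z - c)⁻¹ * P.eval (z - c)⁻¹
      = ∑ i ∈ Finset.range (P.natDegree + 1), P.coeff i * (z - c) ^ (-(i + 1 : ℤ)) := fun z => by
    rw [Polynomial.eval_eq_sum_range, Finset.mul_sum]
    refine Finset.sum_congr rfl fun i _ => ?_
    rw [zpow_neg, ← Nat.cast_succ, zpow_natCast, pow_succ, mul_inv, inv_pow]
    ring
  have h2 : ∀ i ∈ Finset.range (P.natDegree + 1),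
      CircleIntegrable (fun z => P.coeff i * (z - c) ^ (-(i + 1 : ℤ))) x R := fun i _ =>
    IntervalIntegrable.const_mul (hci _) _
  simp_rw [h1]
  rw [circleIntegral.integral_fun_sum h2, Finset.sum_eq_single 0]
  · rw [circleIntegral.integral_const_mul]
    simp only [Nat.cast_zero, zero_add, zpow_neg_one]
    rw [circleIntegral.integral_sub_inv_of_mem_ball hc]
    ring
  · intro i _ hi
    rw [circleIntegral.integral_const_mul, circleIntegral.integral_sub_zpow_of_ne (by omega),
      mul_zero]
  · simp

theorem circleIntegrable_principalPart (P : Polynomial ℂ) {c x : ℂ} {R : ℝ}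
    (hc : c ∈ Metric.ball x R) :
    CircleIntegrable (fun z => (z - c)⁻¹ * P.eval (z - c)⁻¹) x R := by
  have hR : 0 < R := Metric.pos_of_mem_ball hc
  refine ContinuousOn.circleIntegrable hR.le ?_
  have h : ContinuousOn (fun z => (z - c)⁻¹) (Metric.sphere x R) := by
    refine ContinuousOn.inv₀ (by fun_prop) fun z hz h => ?_
    rw [sub_eq_zero.1 h] at hz
    exact (Metric.mem_ball.1 hc).ne (Metric.mem_sphere.1 hz)
  exact h.mul (P.continuous.comp_continuousOn h)

/-- The residue theorem on a disc. -/
theorem circleIntegral_eq_sum_residues (T : Finset ℂ) (f : ℂ → ℂ) (a : ℂ → ℂ) {x : ℂ} {R : ℝ}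
    (hR : 0 < R) (hT : ∀ c ∈ T, c ∈ Metric.ball x R)
    (hd : ∀ z ∈ Metric.closedBall x R, z ∉ T → DifferentiableAt ℂ f z)
    (ha : ∀ c ∈ T, HasRes f c (a c)) :
    (∮ z in C(x, R), f z) = 2 * Real.pi * Complex.I * ∑ c ∈ T, a c := by
  classical
  induction T using Finset.induction_on generalizing f with
  | empty =>
    simp only [Finset.sum_empty, mul_zero]
    refine Complex.circleIntegral_eq_zero_of_differentiable_on_off_countable hR.le
      Set.countable_empty (fun z hz => (hd z hz (by simp)).continuousAt.continuousWithinAt)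
      fun z hz => hd z (Metric.ball_subset_closedBall hz.1) (by simp)
  | insert c T hcT ih =>
    have hcB := hT c (by simp)
    obtain ⟨P, hPa, hP⟩ := ha c (by simp)
    set p : ℂ → ℂ := fun z => (z - c)⁻¹ * P.eval (z - c)⁻¹ with hp
    have hpd : ∀ z, z ≠ c → DifferentiableAt ℂ p z := fun z hz => by
      have h : DifferentiableAt ℂ (fun z => (z - c)⁻¹) z :=
        (differentiableAt_id.sub_const c).inv (sub_ne_zero.2 hz)
      exact h.mul (P.differentiable.differentiableAt.comp z h)
    -- Subtracting the principal part leaves a bounded function near `c`; filling in its limit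
    -- removes the singularity, so the induction hypothesis applies to `g` with one pole fewer.
    set g : ℂ → ℂ := Function.update (fun z => f z - p z) c (limUnder (𝓝[≠] c) fun z => f z - p z)
      with hg
    have hgf : ∀ z, z ≠ c → g =ᶠ[𝓝 z] fun z => f z - p z := fun z hz => by
      filter_upwards [isOpen_ne.mem_nhds hz] with w hw
      exact Function.update_of_ne hw _ _
    have hU : Metric.ball x R \ T ∈ 𝓝 c :=
      (Metric.isOpen_ball.sdiff T.finite_toSet.isClosed).mem_nhds ⟨hcB, by simpa using hcT⟩
    have hgc : DifferentiableAt ℂ g c := by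
      refine (Complex.differentiableOn_update_limUnder_of_isLittleO hU ?_ ?_).differentiableAt hU
      · rintro z ⟨⟨hz, hzT⟩, hzc⟩
        have hzc' : z ≠ c := hzc
        refine ((hd z (Metric.ball_subset_closedBall hz) ?_).sub
          (hpd z hzc')).differentiableWithinAt
        simpa [hzc'] using hzT
      · have h1 : (fun z => f z - p z - (f c - p c)) =O[𝓝[≠] c] (fun _ => (1 : ℂ)) :=
          hP.sub (isBigO_const_const _ one_ne_zero _)
        refine h1.trans_isLittleO (isLittleO_const_left.2 (Or.inr ?_))
        exact tendsto_norm_cobounded_atTop.comp (tendsto_inv₀_nhdsNE_zero.comp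
          (by
            refine tendsto_nhdsWithin_iff.2 ⟨?_, ?_⟩
            · have : Tendsto (fun z => z - c) (𝓝 c) (𝓝 0) := by
                simpa using (tendsto_id (x := 𝓝 c)).sub_const c
              exact this.mono_left nhdsWithin_le_nhds
            · filter_upwards [self_mem_nhdsWithin] with z hz using sub_ne_zero.2 hz))
    have hgi := ih g (fun z hz => hT z (by simp [hz])) ?_ ?_
    · have hsph : ∀ z ∈ Metric.sphere x R, z ∉ insert c T := fun z hz hz' =>
        (Metric.mem_ball.1 (hT z hz')).ne (Metric.mem_sphere.1 hz)
      have hfi : CircleIntegrable f x R := ContinuousOn.circleIntegrable hR.le fun z hz =>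
        (hd z (Metric.sphere_subset_closedBall hz) (hsph z hz)).continuousAt.continuousWithinAt
      have h1 : (∮ z in C(x, R), g z) = ∮ z in C(x, R), (f z - p z) :=
        circleIntegral.integral_congr hR.le fun z hz =>
          Function.update_of_ne (fun h => hsph z hz (by simp [h])) _ _
      rw [h1, circleIntegral.integral_sub hfi (circleIntegrable_principalPart P hcB),
        circleIntegral_principalPart P hcB, hPa] at hgi
      rw [Finset.sum_insert hcT, mul_add, ← hgi]
      ring
    · intro z hz hzT
      by_cases hzc : z = c
      · rw [hzc]; exact hgc
      · exact ((hd z hz (by simp [hzc, hzT])).sub (hpd z hzc)).congr_of_eventuallyEq (hgf z hzc)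
    · intro d hd'
      have hdc : d ≠ c := fun h => hcT (h ▸ hd')
      have h1 : HasRes (fun z => (-1) * p z) d 0 := by
        refine hasRes_of_isBigO_one ?_
        have := ((hpd d hdc).continuousAt.const_mul (-1)).isBigO_one ℂ
        exact this.mono nhdsWithin_le_nhds
      have h2 := (ha d (by simp [hd'])).add h1
      rw [add_zero] at h2
      refine h2.congr ?_
      filter_upwards [(hgf d hdc).filter_mono nhdsWithin_le_nhds] with z hz
      rw [hz]; ring

/-- By the residue theorem with one pole, the integral does not depend on `R` once `R` is small, so
the limit is that of a constant. -/
theorem residue_eq_of_hasRes {f : ℂ → ℂ} {c a : ℂ} (hd : ∀ᶠ z in 𝓝[≠] c, DifferentiableAt ℂ f z)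
    (ha : HasRes f c a) : residue f c = a := by
  refine Tendsto.limUnder_eq (tendsto_const_nhds.congr' ?_)
  rw [eventually_nhdsWithin_iff, Metric.eventually_nhds_iff_ball] at hd
  obtain ⟨ε, hε, hd⟩ := hd
  filter_upwards [Ioo_mem_nhdsGT hε] with R hR
  rw [circleIntegral_eq_sum_residues {c} f (fun _ => a) hR.1
    (by simpa using hR.1) (fun z hz hz' => hd z ?_ (by simpa using hz')) (by simpa using ha)]
  · rw [Finset.sum_singleton, inv_mul_cancel_left₀ Complex.two_pi_I_ne_zero]
  · exact Metric.closedBall_subset_ball hR.2 hz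

/-! ### The partial fraction series of the polygamma functions -/

/-- The `k`-th factor of the Weierstrass product of `1 / Γ`. -/
def gammaFactor (k : ℕ) (z : ℂ) : ℂ := (1 + z / (k + 1)) * Complex.exp (-(z / (k + 1)))

theorem differentiable_gammaFactor (k : ℕ) : Differentiable ℂ (gammaFactor k) := by
  unfold gammaFactor
  fun_prop

/-- The linear terms of `(1+u) exp(-u)` cancel, which is what makes the Weierstrass product
converge. -/
theorem norm_gammaFactor_sub_one_le {k : ℕ} {z : ℂ} (hz : ‖z / (k + 1)‖ ≤ 1) :
    ‖gammaFactor k z - 1‖ ≤ 3 * ‖z / (k + 1)‖ ^ 2 := by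
  set u := z / ((k : ℂ) + 1) with hu
  have h1 := Complex.norm_exp_sub_one_sub_id_le (x := -u) (by rwa [norm_neg])
  have h2 : gammaFactor k z - 1 = (1 + u) * (Complex.exp (-u) - 1 - -u) - u ^ 2 := by
    rw [gammaFactor, ← hu]; ring
  have h3 : ‖1 + u‖ ≤ 2 := (norm_add_le _ _).trans (by rw [norm_one]; linarith)
  rw [norm_neg] at h1
  calc ‖gammaFactor k z - 1‖ ≤ ‖1 + u‖ * ‖Complex.exp (-u) - 1 - -u‖ + ‖u‖ ^ 2 := by
        rw [h2, ← norm_pow, ← norm_mul]; exact norm_sub_le _ _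
    _ ≤ 2 * ‖u‖ ^ 2 + ‖u‖ ^ 2 := by gcongr
    _ = 3 * ‖u‖ ^ 2 := by ring

theorem summable_inv_succ_sq : Summable fun k : ℕ => 1 / ((k : ℝ) + 1) ^ 2 := by
  have := (summable_nat_add_iff 1).2 (Real.summable_one_div_nat_pow.2 one_lt_two)
  simpa using this

theorem hasProdLocallyUniformlyOn_gammaFactor (M : ℝ) :
    HasProdLocallyUniformlyOn gammaFactor (fun z => ∏' k, gammaFactor k z)
      (Metric.ball (0 : ℂ) M) := by
  have h := Summable.hasProdLocallyUniformlyOn_nat_one_add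
    (f := fun k z => gammaFactor k z - 1) (K := Metric.ball (0 : ℂ) M) Metric.isOpen_ball
    (summable_inv_succ_sq.mul_left (3 * M ^ 2)) ?_
    (fun n => ((differentiable_gammaFactor n).continuous.sub continuous_const).continuousOn)
  · simpa using h
  · filter_upwards [eventually_ge_atTop ⌈M⌉₊] with n hn z hz
    have hz' : ‖z‖ < M := by simpa using hz
    have hn' : M ≤ n := Nat.ceil_le.1 hn
    have h1 : ‖z / ((n : ℂ) + 1)‖ = ‖z‖ / (n + 1) := by
      rw [norm_div]; congr 1; exact_mod_cast Complex.norm_natCast (n + 1)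
    have h2 : ‖z / ((n : ℂ) + 1)‖ ≤ 1 := by
      rw [h1, div_le_one (by positivity)]; linarith
    refine (norm_gammaFactor_sub_one_le h2).trans ?_
    rw [h1, div_pow, mul_div_assoc', mul_one_div]
    gcongr

/-- The factor `n^z` in Euler's sequence `GammaSeq` turns `exp(-z H_n)` into `exp(-z (H_n - log
n))`, whose exponent converges to `-zγ`. -/
theorem prod_gammaFactor {z : ℂ} (hz : ∀ m : ℕ, z ≠ -m) {n : ℕ} (hn : n ≠ 0) :
    ∏ k ∈ Finset.range n, gammaFactor k z =
      Complex.exp (-(z * ((harmonic n - Real.log n : ℝ) : ℂ))) / (Complex.GammaSeq z n * z) := by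
  have h1 : ∏ k ∈ Finset.range n, (1 + z / ((k : ℂ) + 1)) =
      (∏ k ∈ Finset.range n, (z + ((k + 1 : ℕ) : ℂ))) / n.factorial := by
    rw [← Finset.prod_range_add_one_eq_factorial, Nat.cast_prod, ← Finset.prod_div_distrib]
    refine Finset.prod_congr rfl fun k _ => ?_
    have : (k : ℂ) + 1 ≠ 0 := Nat.cast_add_one_ne_zero k
    push_cast
    field_simp
    ring
  have h2 : ∏ k ∈ Finset.range n, Complex.exp (-(z / ((k : ℂ) + 1))) =
      Complex.exp (-(z * ((harmonic n : ℝ) : ℂ))) := by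
    rw [← Complex.exp_sum, Finset.sum_neg_distrib, harmonic]
    push_cast
    rw [Finset.mul_sum]
    simp [div_eq_mul_inv]
  have h0 : z ≠ 0 := by simpa using hz 0
  have hP : ∏ k ∈ Finset.range n, (z + ((k + 1 : ℕ) : ℂ)) ≠ 0 :=
    Finset.prod_ne_zero_iff.2 fun k _ h => hz (k + 1) (eq_neg_of_add_eq_zero_left h)
  have hn' : (n : ℂ) ≠ 0 := Nat.cast_ne_zero.2 hn
  have hf : (n.factorial : ℂ) ≠ 0 := Nat.cast_ne_zero.2 n.factorial_ne_zero
  have h3 : Complex.exp (-(z * ((harmonic n - Real.log n : ℝ) : ℂ))) =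
      Complex.exp (-(z * ((harmonic n : ℝ) : ℂ))) * (n : ℂ) ^ z := by
    rw [Complex.cpow_def_of_ne_zero hn', ← Complex.exp_add]
    push_cast
    ring_nf
  have hc : (n : ℂ) ^ z ≠ 0 := by simp [Complex.cpow_eq_zero_iff, hn']
  unfold gammaFactor
  rw [Finset.prod_mul_distrib, h1, h2, h3, Complex.GammaSeq, Finset.prod_range_succ']
  simp only [Nat.cast_zero, add_zero]
  field_simp

theorem tprod_gammaFactor {z : ℂ} (hz : ∀ m : ℕ, z ≠ -m) :
    ∏' k, gammaFactor k z =
      Complex.exp (-(z * Real.eulerMascheroniConstant)) / (Complex.Gamma z * z) := by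
  have h1 := ((hasProdLocallyUniformlyOn_gammaFactor (‖z‖ + 1)).hasProd
    (x := z) (by simp)).tendsto_prod_nat
  have h0 : z ≠ 0 := by simpa using hz 0
  have h2 := (((Complex.continuous_exp.tendsto _).comp
    ((((Complex.continuous_ofReal.tendsto _).comp Real.tendsto_harmonic_sub_log).const_mul
      z).neg)).div ((Complex.GammaSeq_tendsto_Gamma z).mul_const z)
      (mul_ne_zero (Complex.Gamma_ne_zero hz) h0))
  refine tendsto_nhds_unique h1 (h2.congr' ?_)
  filter_upwards [eventually_ne_atTop 0] with n hn
  rw [prod_gammaFactor hz hn]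
  rfl

/-- Away from the poles of `Γ`, points near `z` stay away from `-k` at a linear rate in `k`. -/
theorem exists_le_norm_add_natCast {z : ℂ} (hz : ∀ m : ℕ, z ≠ -m) :
    ∃ c : ℝ, 0 < c ∧ ∀ w ∈ Metric.ball z c, ∀ k : ℕ, c * (k + 1) ≤ ‖w + k‖ := by
  -- The ratio `(k+1)/‖z+k‖` converges, hence is bounded by some `B`. The choice `c = 1/(2B)` gives
  -- up half of the lower bound to let `w` move away from `z`.
  have h1 : Tendsto (fun k : ℕ => ‖((k + 1 : ℕ) : ℂ) / ((k + 1 : ℕ) + (z - 1))‖) atTop (𝓝 ‖(1 : ℂ)‖) :=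
    ((tendsto_natCast_div_add_atTop (z - 1)).comp (tendsto_add_atTop_nat 1)).norm
  obtain ⟨B, hB⟩ := h1.bddAbove_range
  have hpos : ∀ k : ℕ, 0 < ‖z + k‖ := fun k =>
    norm_pos_iff.2 fun h => hz k (eq_neg_of_add_eq_zero_left h)
  have hB' : ∀ k : ℕ, (k : ℝ) + 1 ≤ B * ‖z + k‖ := fun k => by
    have := hB (Set.mem_range_self k)
    simp only [norm_div] at this
    rw [Complex.norm_natCast, show (((k + 1 : ℕ) : ℂ) + (z - 1)) = z + k by push_cast; ring,
      div_le_iff₀ (hpos k)] at this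
    exact_mod_cast this
  have hB0 : 0 < B := by
    have h := hB' 0
    by_contra hneg
    have := mul_nonpos_of_nonpos_of_nonneg (not_lt.1 hneg) (hpos 0).le
    simp at h this
    linarith
  refine ⟨1 / (2 * B), by positivity, fun w hw k => ?_⟩
  have h2 : ‖z + k‖ ≤ ‖w + k‖ + 1 / (2 * B) := by
    have : z + k = (w + k) - (w - z) := by ring
    rw [this]
    refine (norm_sub_le _ _).trans ?_
    rw [← dist_eq_norm w z]
    gcongr
    exact (Metric.mem_ball.1 hw).le
  have h3 : ((k : ℝ) + 1) / B ≤ ‖z + k‖ := by rw [div_le_iff₀ hB0, mul_comm]; exact hB' k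
  have h4 : 1 / (2 * B) ≤ 1 / (2 * B) * (k + 1) := by
    have : (0 : ℝ) ≤ k := Nat.cast_nonneg k
    exact le_mul_of_one_le_right (by positivity) (by linarith)
  have h5 : ((k : ℝ) + 1) / B = 2 * (1 / (2 * B) * (k + 1)) := by field_simp
  linarith

theorem eventually_ne_neg_natCast {z : ℂ} (hz : ∀ m : ℕ, z ≠ -m) :
    ∀ᶠ w : ℂ in 𝓝 z, ∀ m : ℕ, w ≠ -m := by
  obtain ⟨c, hc, h⟩ := exists_le_norm_add_natCast hz
  filter_upwards [Metric.ball_mem_nhds z hc] with w hw m hm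
  have := h w hw m
  rw [hm, neg_add_cancel, norm_zero] at this
  have : 0 < c * (m + 1) := by positivity
  linarith

/-- Locally uniform convergence of the Weierstrass product allows taking logarithmic derivatives
factor by factor. -/
theorem tendsto_sum_digamma {z : ℂ} (hz : ∀ m : ℕ, z ≠ -m) :
    Tendsto (fun n => ∑ k ∈ Finset.range n, (1 / (z + (k + 1)) - 1 / ((k : ℂ) + 1))) atTop
      (𝓝 (-(Real.eulerMascheroniConstant : ℂ) - (Complex.digamma z + 1 / z))) := by
  have h0 : z ≠ 0 := by simpa using hz 0
  have hG := Complex.Gamma_ne_zero hz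
  have hval := tprod_gammaFactor hz
  have h1 := Complex.logDeriv_tendsto (x := z) Metric.isOpen_ball (by simp)
    (hasProdLocallyUniformlyOn_gammaFactor (‖z‖ + 1)).tendstoLocallyUniformlyOn_finsetRange
    (Eventually.of_forall fun n => (Differentiable.fun_finsetProd fun k _ =>
      differentiable_gammaFactor k).differentiableOn) (by
        rw [hval]; exact div_ne_zero (Complex.exp_ne_zero _) (mul_ne_zero hG h0))
  have h2 : logDeriv (fun z => ∏' k, gammaFactor k z) z =
      -(Real.eulerMascheroniConstant : ℂ) - (Complex.digamma z + 1 / z) := by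
    have he : (fun z => ∏' k, gammaFactor k z) =ᶠ[𝓝 z] fun w =>
        Complex.exp (-(w * Real.eulerMascheroniConstant)) / (Complex.Gamma w * w) := by
      filter_upwards [eventually_ne_neg_natCast hz] with w hw using tprod_gammaFactor hw
    have hd := Complex.differentiableAt_Gamma z hz
    rw [logDeriv_apply, he.deriv_eq, he.eq_of_nhds, ← logDeriv_apply,
      logDeriv_div (f := fun w => Complex.exp (-(w * Real.eulerMascheroniConstant)))
        (g := fun w => Complex.Gamma w * w) z (Complex.exp_ne_zero _) (mul_ne_zero hG h0)
        (by fun_prop) (hd.mul differentiableAt_id),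
      logDeriv_mul (g := fun w => w) z hG h0 hd differentiableAt_id, Complex.digamma_def, logDeriv_apply]
    congr 1
    · have : HasDerivAt (fun w : ℂ => Complex.exp (-(w * Real.eulerMascheroniConstant)))
          (Complex.exp (-(z * Real.eulerMascheroniConstant)) *
            (-(1 * (Real.eulerMascheroniConstant : ℂ)))) z :=
        (((hasDerivAt_id z).mul_const _).neg).cexp
      rw [this.deriv, mul_div_cancel_left₀ _ (Complex.exp_ne_zero _), one_mul]
    · simp [logDeriv_apply]
  rw [h2] at h1
  refine h1.congr fun n => ?_
  have hk : ∀ k : ℕ, (k : ℂ) + 1 ≠ 0 := Nat.cast_add_one_ne_zero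
  have hzk : ∀ k : ℕ, z + (k + 1) ≠ 0 := fun k h => hz (k + 1)
    (by push_cast; exact eq_neg_of_add_eq_zero_left h)
  have hlin : ∀ k : ℕ, 1 + z / ((k : ℂ) + 1) ≠ 0 := fun k => by
    have h := hk k
    have : 1 + z / ((k : ℂ) + 1) = (z + (k + 1)) / (k + 1) := by field_simp; ring
    rw [this]; exact div_ne_zero (hzk k) h
  rw [logDeriv_prod (f := gammaFactor) (fun k _ => mul_ne_zero (hlin k) (Complex.exp_ne_zero _))
    fun k _ => differentiable_gammaFactor k z]
  refine Finset.sum_congr rfl fun k _ => ?_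
  have h3 : HasDerivAt (fun w : ℂ => 1 + w / ((k : ℂ) + 1)) (1 / (k + 1)) z :=
    ((hasDerivAt_id z).div_const _).const_add 1
  have h4 : HasDerivAt (fun w : ℂ => Complex.exp (-(w / ((k : ℂ) + 1))))
      (Complex.exp (-(z / (k + 1))) * (-(1 / (k + 1)))) z :=
    (((hasDerivAt_id z).div_const _).neg).cexp
  have h5 : logDeriv (gammaFactor k) z = _ :=
    logDeriv_mul z (hlin k) (Complex.exp_ne_zero _) h3.differentiableAt h4.differentiableAt
  rw [h5, logDeriv_apply, logDeriv_apply, h3.deriv, h4.deriv,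
    mul_div_cancel_left₀ _ (Complex.exp_ne_zero _)]
  have := hk k
  have h6 := hlin k
  have h7 := hzk k
  have : 1 + z / ((k : ℂ) + 1) = (z + (k + 1)) / (k + 1) := by field_simp; ring
  rw [this]
  field_simp
  ring

/-- The terms of the partial fraction series of `ψ^{(p-1)} / (p-1)!` (and of `ψ + γ` if `p = 1`). -/
def polyTerm (p k : ℕ) (z : ℂ) : ℂ :=
  (if p = 1 then 1 / ((k : ℂ) + 1) else 0) + (-1) ^ p / (z + k) ^ p

/-- For `p = 1` the correction `1/(k+1)` cancels the leading term and leaves `(w-1)/((k+1)(w+k))`,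
again of order `k⁻²`. One majorant therefore serves every `p`. -/
theorem norm_polyTerm_le {p : ℕ} (hp : 1 ≤ p) {c M : ℝ} (hc : 0 < c) {w : ℂ} (hw : ‖w‖ ≤ M) {k : ℕ}
    (h : c * (k + 1) ≤ ‖w + k‖) :
    ‖polyTerm p k w‖ ≤ ((M + 1) / c + 1 / c ^ p) * (1 / ((k : ℝ) + 1) ^ 2) := by
  have hk : (0 : ℝ) < k + 1 := by positivity
  have hk' : (k : ℂ) + 1 ≠ 0 := Nat.cast_add_one_ne_zero k
  have hkn : ‖(k : ℂ) + 1‖ = k + 1 := by exact_mod_cast Complex.norm_natCast (k + 1)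
  have hM : 0 ≤ M := (norm_nonneg w).trans hw
  have hwk : 0 < ‖w + k‖ := lt_of_lt_of_le (by positivity) h
  have hwk' : w + k ≠ 0 := norm_pos_iff.1 hwk
  rw [add_mul]
  by_cases hp1 : p = 1
  · subst hp1
    have h1 : polyTerm 1 k w = (w - 1) / ((k + 1) * (w + k)) := by
      simp only [polyTerm, if_true, pow_one]
      field_simp
      ring
    have h2 : ‖w - 1‖ ≤ M + 1 := (norm_sub_le _ _).trans (by rw [norm_one]; linarith)
    rw [h1, norm_div, norm_mul, hkn]
    have : (0 : ℝ) ≤ 1 / c ^ 1 * (1 / ((k : ℝ) + 1) ^ 2) := by positivity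
    refine le_trans ?_ (le_add_of_nonneg_right this)
    calc ‖w - 1‖ / ((k + 1) * ‖w + k‖) ≤ (M + 1) / ((k + 1) * (c * (k + 1))) := by gcongr
      _ = _ := by field_simp
  · have h1 : ‖polyTerm p k w‖ = 1 / ‖w + k‖ ^ p := by
      simp [polyTerm, hp1]
    rw [h1]
    have : (0 : ℝ) ≤ (M + 1) / c * (1 / ((k : ℝ) + 1) ^ 2) := by positivity
    refine le_trans ?_ (le_add_of_nonneg_left this)
    calc 1 / ‖w + k‖ ^ p ≤ 1 / (c * (k + 1)) ^ p := by gcongr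
      _ = 1 / c ^ p * (1 / ((k : ℝ) + 1) ^ p) := by rw [mul_pow]; field_simp
      _ ≤ _ := by
        gcongr
        · linarith [Nat.cast_nonneg (α := ℝ) k]
        · omega

theorem exists_norm_polyTerm_le {p : ℕ} (hp : 1 ≤ p) {z : ℂ} (hz : ∀ m : ℕ, z ≠ -m) :
    ∃ c C : ℝ, 0 < c ∧ (∀ w ∈ Metric.ball z c, ∀ m : ℕ, w ≠ -m) ∧
      ∀ k, ∀ w ∈ Metric.ball z c, ‖polyTerm p k w‖ ≤ C * (1 / ((k : ℝ) + 1) ^ 2) := by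
  obtain ⟨c, hc, h⟩ := exists_le_norm_add_natCast hz
  refine ⟨c, (‖z‖ + c + 1) / c + 1 / c ^ p, hc, fun w hw m hm => ?_, fun k w hw =>
    norm_polyTerm_le hp hc ?_ (h w hw k)⟩
  · have := h w hw m
    rw [hm, neg_add_cancel, norm_zero] at this
    have : 0 < c * (m + 1) := by positivity
    linarith
  · have h1 : ‖w - z‖ < c := by rw [← dist_eq_norm]; exact hw
    calc ‖w‖ = ‖z + (w - z)‖ := by ring_nf
      _ ≤ ‖z‖ + c := (norm_add_le _ _).trans (by linarith)

theorem hasSum_digamma {z : ℂ} (hz : ∀ m : ℕ, z ≠ -m) :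
    HasSum (fun k => polyTerm 1 k z) (Complex.digamma z + Real.eulerMascheroniConstant) := by
  obtain ⟨c, C, hc, -, hC⟩ := exists_norm_polyTerm_le le_rfl hz
  have hs : Summable fun k => polyTerm 1 k z :=
    Summable.of_norm_bounded (summable_inv_succ_sq.mul_left C)
      fun k => hC k z (Metric.mem_ball_self hc)
  rw [hs.hasSum_iff_tendsto_nat]
  have h1 := (tendsto_sum_digamma hz).neg
  have h2 : Tendsto (fun n : ℕ => 1 / (z + n)) atTop (𝓝 0) := by
    simp only [one_div]
    refine tendsto_inv₀_cobounded.comp ?_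
    refine tendsto_norm_atTop_iff_cobounded.1 (tendsto_atTop_mono (fun n => ?_)
      (tendsto_atTop_add_const_right atTop (-‖z‖) tendsto_natCast_atTop_atTop))
    have := norm_sub_le (z + n) z
    rw [add_sub_cancel_left, Complex.norm_natCast] at this
    linarith
  -- The limit found so far belongs to `ψ(z+1) = ψ(z) + 1/z`. Moving the index down by one changes
  -- the partial sums by `1/(z+n) - 1/z`.
  have h3 := (h1.add h2).sub_const (1 / z)
  have h0 : -(-(Real.eulerMascheroniConstant : ℂ) - (Complex.digamma z + 1 / z)) + 0 - 1 / z
      = Complex.digamma z + Real.eulerMascheroniConstant := by ring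
  rw [h0] at h3
  refine h3.congr fun n => ?_
  induction n with
  | zero => simp
  | succ n ih =>
    rw [Finset.sum_range_succ, Finset.sum_range_succ, ← ih, polyTerm]
    push_cast
    simp
    ring

theorem hasDerivAt_polyTerm (p k : ℕ) {z : ℂ} (hz : z + k ≠ 0) :
    HasDerivAt (polyTerm (p + 1) k) ((p + 1 : ℂ) * polyTerm (p + 2) k z) z := by
  have h1 : HasDerivAt (fun w : ℂ => (w + k) ^ (p + 1)) (((p + 1 : ℕ) : ℂ) * (z + k) ^ p * 1) z :=
    ((hasDerivAt_id z).add_const (k : ℂ)).pow (p + 1)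
  have h2 := ((h1.inv (pow_ne_zero _ hz)).const_mul ((-1 : ℂ) ^ (p + 1))).const_add
    (if p + 1 = 1 then 1 / ((k : ℂ) + 1) else 0)
  refine h2.congr_deriv ?_
  simp only [polyTerm, show p + 2 ≠ 1 by omega, if_false]
  push_cast
  field_simp
  ring

/-- Termwise differentiation, step by step: each derivative brings out the factor `j+1` that the
factorial absorbs, and the first one removes `γ`. -/
theorem hasSum_polyTerm_aux (j : ℕ) : ∀ z : ℂ, (∀ m : ℕ, z ≠ -m) →
    HasSum (fun k => polyTerm (j + 1) k z)
      ((polygamma j z + if j = 0 then (Real.eulerMascheroniConstant : ℂ) else 0) / j.factorial) := by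
  induction j with
  | zero =>
    intro z hz
    simpa [polygamma] using hasSum_digamma hz
  | succ j ih =>
    intro z hz
    obtain ⟨c, C, hc, hU, hC⟩ := exists_norm_polyTerm_le (p := j + 1) (by omega) hz
    have hne : ∀ w ∈ Metric.ball z c, ∀ k : ℕ, w + k ≠ 0 := fun w hw k h =>
      hU w hw k (eq_neg_of_add_eq_zero_left h)
    have hzb := Metric.mem_ball_self (x := z) hc
    have h1 := Complex.hasSum_deriv_of_summable_norm (summable_inv_succ_sq.mul_left C)
      (fun k w hw => (hasDerivAt_polyTerm j k (hne w hw k)).differentiableAt.differentiableWithinAt)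
      Metric.isOpen_ball hC hzb
    have h2 : (fun w => ∑' k, polyTerm (j + 1) k w) =ᶠ[𝓝 z] fun w =>
        (polygamma j w + if j = 0 then (Real.eulerMascheroniConstant : ℂ) else 0) /
          j.factorial := by
      filter_upwards [Metric.ball_mem_nhds z hc] with w hw using (ih w (hU w hw)).tsum_eq
    rw [h2.deriv_eq, deriv_div_const, deriv_add_const] at h1
    have h3 : deriv (polygamma j) z = polygamma (j + 1) z := by
      simp only [polygamma, iteratedDeriv_succ]
      rfl
    have h4 : (fun k => deriv (polyTerm (j + 1) k) z) =
        fun k => (j + 1 : ℂ) * polyTerm (j + 2) k z :=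
      funext fun k => (hasDerivAt_polyTerm j k (hne z hzb k)).deriv
    have h5 : (j : ℂ) + 1 ≠ 0 := Nat.cast_add_one_ne_zero j
    have h6 := h1.mul_left ((j : ℂ) + 1)⁻¹
    change HasSum (fun k => ((j : ℂ) + 1)⁻¹ * (fun k => deriv (polyTerm (j + 1) k) z) k) _ at h6
    rw [h4] at h6
    simp only [inv_mul_cancel_left₀ h5] at h6
    convert h6 using 1
    simp only [Nat.succ_ne_zero, if_false, add_zero, Nat.factorial_succ]
    rw [← h3]
    push_cast
    field_simp

/-- `ψ^{(p-1)} / (p-1)!` (and `ψ + γ` if `p = 1`). -/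
def scaledPolygamma (p : ℕ) (z : ℂ) : ℂ := normPolygamma p z / (p - 1).factorial

theorem hasSum_polyTerm {p : ℕ} (hp : 1 ≤ p) {z : ℂ} (hz : ∀ m : ℕ, z ≠ -m) :
    HasSum (fun k => polyTerm p k z) (scaledPolygamma p z) := by
  obtain ⟨j, rfl⟩ := Nat.exists_eq_add_of_le' hp
  convert hasSum_polyTerm_aux j z hz using 1
  by_cases hj : j = 0
  · simp [scaledPolygamma, normPolygamma, hj]
  · simp [scaledPolygamma, normPolygamma, hj]

theorem differentiableAt_scaledPolygamma {p : ℕ} (hp : 1 ≤ p) {z : ℂ} (hz : ∀ m : ℕ, z ≠ -m) :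
    DifferentiableAt ℂ (scaledPolygamma p) z := by
  obtain ⟨c, C, hc, hU, hC⟩ := exists_norm_polyTerm_le hp hz
  obtain ⟨j, rfl⟩ := Nat.exists_eq_add_of_le' hp
  have h1 := Complex.differentiableOn_tsum_of_summable_norm (summable_inv_succ_sq.mul_left C)
    (fun k w hw => (hasDerivAt_polyTerm j k fun h =>
      hU w hw k (eq_neg_of_add_eq_zero_left h)).differentiableAt.differentiableWithinAt)
    Metric.isOpen_ball hC
  refine (h1.differentiableAt (Metric.ball_mem_nhds z hc)).congr_of_eventuallyEq ?_
  filter_upwards [Metric.ball_mem_nhds z hc] with w hw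
  exact (hasSum_polyTerm hp (hU w hw)).tsum_eq.symm

/-- For `p ≥ 2` this is an index shift in the series. For `p = 1` the correcting terms `1/(k+1)` do
not shift along, and the functional equation of `ψ` is used instead. -/
theorem scaledPolygamma_add_one {p : ℕ} (hp : 1 ≤ p) {z : ℂ} (hz : ∀ m : ℕ, z ≠ -m) :
    scaledPolygamma p (z + 1) = scaledPolygamma p z - (-1) ^ p / z ^ p := by
  have hz1 : ∀ m : ℕ, z + 1 ≠ -m := fun m h => hz (m + 1) (by
    push_cast; linear_combination h)
  by_cases hp1 : p = 1
  · subst hp1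
    simp only [scaledPolygamma, normPolygamma, polygamma, if_true, iteratedDeriv_zero,
      Complex.digamma_apply_add_one z hz]
    simp
    ring
  · have h1 := (hasSum_nat_add_iff' 1).2 (hasSum_polyTerm hp hz)
    have h2 := hasSum_polyTerm hp hz1
    have h3 : (fun k => polyTerm p k (z + 1)) = fun k => polyTerm p (k + 1) z := by
      ext k
      simp only [polyTerm, hp1, if_false]
      push_cast
      ring_nf
    rw [h3] at h2
    rw [h2.unique h1]
    simp [polyTerm, hp1]

theorem scaledPolygamma_add_natCast {p : ℕ} (hp : 1 ≤ p) {z : ℂ} (hz : ∀ m : ℕ, z ≠ -m) (n : ℕ) :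
    scaledPolygamma p (z + n) =
      scaledPolygamma p z - ∑ k ∈ Finset.range n, (-1) ^ p / (z + k) ^ p := by
  induction n with
  | zero => simp
  | succ n ih =>
    have hzn : ∀ m : ℕ, z + n ≠ -m := fun m h => hz (m + n) (by
      push_cast; linear_combination h)
    rw [Finset.sum_range_succ, Nat.cast_succ, ← add_assoc, scaledPolygamma_add_one hp hzn, ih]
    ring

theorem one_ne_neg_natCast (m : ℕ) : (1 : ℂ) ≠ -m := fun h => by
  have h1 : ((1 + m : ℕ) : ℂ) = 0 := by push_cast; linear_combination h
  exact absurd (Nat.cast_eq_zero.1 h1) (by omega)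

theorem summable_one_div_natCast_pow {p : ℕ} (hp : 1 < p) :
    Summable fun n : ℕ => 1 / (n : ℂ) ^ p := by
  simpa using Complex.summable_ofReal.2 (Real.summable_one_div_nat_pow.2 hp)

/-- The two conventions for `p = 1` match here: `ψ(1) + γ = 0` corresponds to `ζ(1) = 0`. -/
theorem scaledPolygamma_one {p : ℕ} (hp : 1 ≤ p) :
    scaledPolygamma p 1 = (-1) ^ p * zetaNat p := by
  by_cases hp1 : p = 1
  · subst hp1
    simp [scaledPolygamma, normPolygamma, polygamma, zetaNat, Complex.digamma_one]
  · have h1 := hasSum_polyTerm hp one_ne_neg_natCast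
    rw [← h1.tsum_eq, zetaNat, if_neg hp1, zeta_nat_eq_tsum_of_gt_one (by omega),
      ← (summable_one_div_natCast_pow (by omega : 1 < p)).sum_add_tsum_nat_add 1]
    simp only [polyTerm, hp1, if_false]
    simp [show p ≠ 0 by omega]
    rw [← tsum_mul_left]
    exact tsum_congr fun k => by rw [add_comm (1 : ℂ)]; ring

theorem genHarmonic_eq_sum_range (p n : ℕ) :
    genHarmonic p n = ∑ k ∈ Finset.range n, 1 / ((k : ℂ) + 1) ^ p := by
  rw [genHarmonic, ← Finset.Ico_add_one_right_eq_Icc, Finset.sum_Ico_eq_sum_range]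
  simp [add_comm]

theorem scaledPolygamma_natCast_add_one {p : ℕ} (hp : 1 ≤ p) (n : ℕ) :
    scaledPolygamma p (n + 1) = (-1) ^ p * (zetaNat p - genHarmonic p n) := by
  rw [add_comm, scaledPolygamma_add_natCast hp one_ne_neg_natCast, scaledPolygamma_one hp,
    genHarmonic_eq_sum_range, mul_sub, Finset.mul_sum]
  congr 1
  exact Finset.sum_congr rfl fun k _ => by rw [add_comm (1 : ℂ)]; ring

/-- The part of `ψ^{(p-1)}(-z) / (p-1)!` that is regular at the natural number `n`. -/
def regularPart (p n : ℕ) (z : ℂ) : ℂ :=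
  ∑ k ∈ Finset.range n, 1 / (z - k) ^ p + scaledPolygamma p (n + 1 - z)

theorem regularPart_self {p : ℕ} (hp : 1 ≤ p) (n : ℕ) :
    regularPart p n n = (-1) ^ p * zetaNat p + genHarmonic p n := by
  rw [regularPart, add_sub_cancel_left, scaledPolygamma_one hp, add_comm, genHarmonic_eq_sum_range,
    ← Finset.sum_range_reflect]
  congr 1
  refine Finset.sum_congr rfl fun k hk => ?_
  have hk' : k + 1 ≤ n := Finset.mem_range.1 hk
  rw [Nat.sub_sub, add_comm 1 k, Nat.cast_sub hk']
  push_cast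
  ring_nf

theorem differentiableAt_regularPart {p : ℕ} (hp : 1 ≤ p) (n : ℕ) :
    DifferentiableAt ℂ (regularPart p n) n := by
  unfold regularPart
  refine DifferentiableAt.add (DifferentiableAt.fun_sum fun k hk => ?_) ?_
  · refine (differentiableAt_const _).div (by fun_prop) (pow_ne_zero _ (sub_ne_zero.2 ?_))
    exact_mod_cast (Finset.mem_range.1 hk).ne'
  · refine DifferentiableAt.comp (n : ℂ) (g := scaledPolygamma p) (f := fun z : ℂ => n + 1 - z) ?_
      (by fun_prop)
    refine differentiableAt_scaledPolygamma hp ?_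
    rw [add_sub_cancel_left]
    exact one_ne_neg_natCast

/-- Applying the recurrence `n+1` times moves the argument from `-z` to `n+1-z`, which is near `1`
when `z` is near `n`. Of the terms picked up, only the last is singular at `n`. -/
theorem scaledPolygamma_neg_eq {p : ℕ} (hp : 1 ≤ p) (n : ℕ) {z : ℂ} (hz : ∀ m : ℕ, z ≠ m) :
    scaledPolygamma p (-z) = (z - n)⁻¹ ^ p + regularPart p n z := by
  have h1 := scaledPolygamma_add_natCast hp (z := -z)
    (fun m h => hz m (neg_inj.1 h)) (n + 1)
  have h2 : ∀ k : ℕ, (-1 : ℂ) ^ p / (-z + k) ^ p = 1 / (z - k) ^ p := fun k => by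
    rw [show -z + k = -1 * (z - k) by ring, mul_pow, div_mul_eq_div_div,
      div_self (pow_ne_zero _ (by norm_num))]
  simp only [h2, Finset.sum_range_succ] at h1
  rw [regularPart, show (n : ℂ) + 1 - z = -z + ((n + 1 : ℕ) : ℂ) by push_cast; ring, h1]
  simp
  ring

/-! ### Bounds and the Laurent expansion of the cotangent -/

theorem summable_inv_sqrt_pow_three :
    Summable fun n : ℤ => 1 / Real.sqrt (|(n : ℝ)| + 1) ^ 3 := by
  have h1 : Summable fun n : ℕ => 1 / Real.sqrt ((n : ℝ) + 1) ^ 3 := by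
    have h2 := (summable_nat_add_iff 1).2
      (Real.summable_nat_rpow_inv.2 (by norm_num : (1 : ℝ) < 3 / 2))
    refine h2.congr fun n => ?_
    rw [Real.sqrt_eq_rpow, ← Real.rpow_natCast, ← Real.rpow_mul (by positivity), one_div]
    push_cast
    norm_num
  refine Summable.of_nat_of_neg ?_ ?_
  · simpa using h1
  · simpa using h1

/-- With `d = |k - ⌊Re z⌋|`: if `d ≤ 1`, then `(d+1)/5 ≤ 2/5 < 1/2`; if `d ≥ 2`, then `(d+1)/5 ≤ d-1
≤ |Re z - k|`. -/
theorem floor_lower_bound {z : ℂ} (hz : ∀ n : ℤ, 1 / 2 ≤ ‖z - n‖) (k : ℤ) :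
    (|((k - ⌊z.re⌋ : ℤ) : ℝ)| + 1) / 5 ≤ ‖z - k‖ := by
  have h1 := hz k
  have h2 : |z.re - k| ≤ ‖z - k‖ := by
    simpa using Complex.abs_re_le_norm (z - k)
  have h3 : |((k - ⌊z.re⌋ : ℤ) : ℝ)| ≤ |z.re - k| + 1 := by
    have h4 := Int.floor_le z.re
    have h5 := Int.lt_floor_add_one z.re
    have : ((k - ⌊z.re⌋ : ℤ) : ℝ) = (z.re - ⌊z.re⌋) - (z.re - k) := by push_cast; ring
    rw [this]
    refine (abs_sub _ _).trans ?_
    rw [abs_of_nonneg (by linarith)]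
    linarith
  have h6 : |((k - ⌊z.re⌋ : ℤ) : ℝ)| ≤ 1 ∨ 2 ≤ |((k - ⌊z.re⌋ : ℤ) : ℝ)| := by
    rw [← Int.cast_abs]
    rcases le_or_gt |k - ⌊z.re⌋| 1 with h | h
    · left; exact_mod_cast h
    · right; exact_mod_cast h
  rcases h6 with h | h <;> linarith

/-- The sum `∑ |z - k|^{-3/2}` is bounded uniformly at distance at least `1/2` from the integers. -/
theorem exists_sum_inv_sqrt_le : ∃ C : ℝ, 0 ≤ C ∧ ∀ z : ℂ, (∀ n : ℤ, 1 / 2 ≤ ‖z - n‖) →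
    Summable (fun k : ℕ => 1 / Real.sqrt ‖z - k‖ ^ 3) ∧
      ∑' k : ℕ, 1 / Real.sqrt ‖z - k‖ ^ 3 ≤ C := by
  set u : ℤ → ℝ := fun n => 1 / Real.sqrt ((|(n : ℝ)| + 1) / 5) ^ 3 with hu
  have hus : Summable u := by
    refine (summable_inv_sqrt_pow_three.mul_left (Real.sqrt 5 ^ 3)).congr fun n => ?_
    simp only [hu]
    rw [Real.sqrt_div (by positivity), div_pow, one_div_div, mul_one_div]
  have hu0 : ∀ n, 0 ≤ u n := fun n => by positivity
  refine ⟨∑' n, u n, tsum_nonneg hu0, fun z hz => ?_⟩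
  have hinj : Function.Injective fun k : ℕ => (k : ℤ) - ⌊z.re⌋ := fun a b h => by
    simpa using h
  have h1 : ∀ k : ℕ, 1 / Real.sqrt ‖z - k‖ ^ 3 ≤ u ((k : ℤ) - ⌊z.re⌋) := fun k => by
    have h := floor_lower_bound hz k
    simp only [hu]
    have : 0 < (|(((k : ℤ) - ⌊z.re⌋ : ℤ) : ℝ)| + 1) / 5 := by positivity
    rw [Int.cast_natCast] at h
    gcongr
  have h2 : Summable fun k : ℕ => u ((k : ℤ) - ⌊z.re⌋) := hus.comp_injective hinj
  have h3 : Summable fun k : ℕ => 1 / Real.sqrt ‖z - k‖ ^ 3 :=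
    Summable.of_nonneg_of_le (fun k => by positivity) h1 h2
  exact ⟨h3, (h3.tsum_le_tsum h1 h2).trans (tsum_comp_le_tsum_of_inj hus hu0 hinj)⟩

theorem inv_mul_sq_le {a b : ℝ} (ha : 0 < a) (hb : 0 < b) :
    1 / (a * b ^ 2) ≤ 1 / a ^ 3 + 1 / b ^ 3 := by
  rcases le_total a b with h | h
  · have : 1 / (a * b ^ 2) ≤ 1 / a ^ 3 := by
      rw [show a ^ 3 = a * a ^ 2 by ring]; gcongr
    have : 0 ≤ 1 / b ^ 3 := by positivity
    linarith
  · have : 1 / (a * b ^ 2) ≤ 1 / b ^ 3 := by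
      rw [show b ^ 3 = b * b ^ 2 by ring]; gcongr
    have : 0 ≤ 1 / a ^ 3 := by positivity
    linarith

/-- A factor `√(‖z‖+1)` is traded for exponents `3/2`, so that what remains has a sum over `k`
bounded uniformly in `z`. This growth is cruder than the true one, but affordable against `r =
O(z⁻²)`. -/
theorem norm_polyTerm_neg_le {p : ℕ} (hp : 1 ≤ p) {z : ℂ} (k : ℕ) (hz : 1 / 2 ≤ ‖z - k‖) :
    ‖polyTerm p k (-z)‖ ≤ Real.sqrt (‖z‖ + 1) * (2 ^ p *
      (1 / Real.sqrt ((k : ℝ) + 1) ^ 3 + 1 / Real.sqrt ‖z - k‖ ^ 3)) := by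
  have hzk : 0 < ‖z - k‖ := by linarith
  set b := Real.sqrt ‖z - k‖ with hb
  set a := Real.sqrt ((k : ℝ) + 1) with ha
  have hb0 : 0 < b := Real.sqrt_pos.2 hzk
  have ha0 : 0 < a := Real.sqrt_pos.2 (by positivity)
  have hb2 : b ^ 2 = ‖z - k‖ := Real.sq_sqrt hzk.le
  have ha2 : a ^ 2 = (k : ℝ) + 1 := Real.sq_sqrt (by positivity)
  have hs1 : 1 ≤ Real.sqrt (‖z‖ + 1) := Real.one_le_sqrt.2 (by linarith [norm_nonneg z])
  have hneg : ‖-z + k‖ = ‖z - k‖ := by rw [← norm_neg]; ring_nf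
  have hpos : 0 ≤ 1 / a ^ 3 + 1 / b ^ 3 := by positivity
  by_cases hp1 : p = 1
  · subst hp1
    have hkn : ‖(k : ℂ) + 1‖ = k + 1 := by exact_mod_cast Complex.norm_natCast (k + 1)
    have hk' : (k : ℂ) + 1 ≠ 0 := Nat.cast_add_one_ne_zero k
    have hzk' : -z + k ≠ 0 := norm_pos_iff.1 (hneg ▸ hzk)
    have h1 : polyTerm 1 k (-z) = (-z - 1) / ((k + 1) * (-z + k)) := by
      simp only [polyTerm, if_true, pow_one]
      field_simp
      ring
    have h2 : ‖polyTerm 1 k (-z)‖ = ‖-z - 1‖ / (a ^ 2 * b ^ 2) := by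
      rw [h1, norm_div, norm_mul, hkn, hneg, ha2, hb2]
    -- The numerator is written `s * s`: one factor becomes `√(‖z‖+1)`, the other is at most `a + b`
    -- because `-z - 1 = (-z + k) - (k + 1)`.
    set s := Real.sqrt ‖-z - 1‖ with hs
    have hs2 : s ^ 2 = ‖-z - 1‖ := Real.sq_sqrt (norm_nonneg _)
    have hsz : s ≤ Real.sqrt (‖z‖ + 1) := by
      refine Real.sqrt_le_sqrt ((norm_sub_le _ _).trans ?_)
      rw [norm_neg, norm_one]
    have hsab : s ≤ a + b := by
      refine Real.sqrt_le_iff.2 ⟨by positivity, ?_⟩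
      have h3 : ‖-z - 1‖ ≤ ‖-z + k‖ + ‖(k : ℂ) + 1‖ := by
        rw [show -z - 1 = (-z + k) - (k + 1) by ring]; exact norm_sub_le _ _
      rw [hneg, hkn, ← ha2, ← hb2] at h3
      nlinarith
    calc ‖polyTerm 1 k (-z)‖ = s * s / (a ^ 2 * b ^ 2) := by rw [h2, ← hs2, sq]
      _ ≤ Real.sqrt (‖z‖ + 1) * (a + b) / (a ^ 2 * b ^ 2) := by gcongr
      _ = Real.sqrt (‖z‖ + 1) * (1 / (a * b ^ 2) + 1 / (b * a ^ 2)) := by field_simp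
      _ ≤ Real.sqrt (‖z‖ + 1) * ((1 / a ^ 3 + 1 / b ^ 3) + (1 / b ^ 3 + 1 / a ^ 3)) := by
        gcongr
        · exact inv_mul_sq_le ha0 hb0
        · exact inv_mul_sq_le hb0 ha0
      _ = _ := by ring
  · have h1 : ‖polyTerm p k (-z)‖ = 1 / ‖z - k‖ ^ p := by
      simp [polyTerm, hp1, hneg]
    have hb2' : 1 ≤ 2 * b := by
      have : (1 / 2) ≤ b := Real.le_sqrt_of_sq_le (by linarith)
      linarith
    have h4 : b ^ 3 ≤ ‖z - k‖ ^ p * 2 ^ p := by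
      obtain ⟨q, rfl⟩ := Nat.exists_eq_add_of_le (show 2 ≤ p by omega)
      have h5 : 1 ≤ 2 * ‖z - k‖ := by linarith
      have h6 : 1 ≤ (2 * ‖z - k‖) ^ q := one_le_pow₀ h5
      have h7 : b ^ 3 ≤ 2 * b ^ 4 := by nlinarith [pow_pos hb0 3]
      calc b ^ 3 ≤ 2 * b ^ 4 := h7
        _ ≤ 4 * (b ^ 2) ^ 2 * 1 := by nlinarith [pow_pos hb0 4]
        _ ≤ 4 * (b ^ 2) ^ 2 * (2 * ‖z - k‖) ^ q := by gcongr
        _ = _ := by rw [hb2, mul_pow, pow_add, pow_add]; ring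
    rw [h1]
    calc 1 / ‖z - k‖ ^ p ≤ 2 ^ p * (1 / b ^ 3) := by
          rw [mul_one_div, div_le_div_iff₀ (by positivity) (by positivity)]
          linarith
      _ ≤ 2 ^ p * (1 / a ^ 3 + 1 / b ^ 3) := by
        gcongr
        exact le_add_of_nonneg_left (by positivity)
      _ ≤ _ := le_mul_of_one_le_left (by positivity) hs1

theorem exists_norm_scaledPolygamma_le {p : ℕ} (hp : 1 ≤ p) :
    ∃ C : ℝ, 0 ≤ C ∧ ∀ z : ℂ, (∀ n : ℤ, 1 / 2 ≤ ‖z - n‖) →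
      ‖scaledPolygamma p (-z)‖ ≤ C * Real.sqrt (‖z‖ + 1) := by
  obtain ⟨C, hC0, hC⟩ := exists_sum_inv_sqrt_le
  have hs0 : Summable fun k : ℕ => 1 / Real.sqrt ((k : ℝ) + 1) ^ 3 := by
    refine (summable_inv_sqrt_pow_three.comp_injective Nat.cast_injective).congr fun n => ?_
    simp
  refine ⟨2 ^ p * (∑' k : ℕ, 1 / Real.sqrt ((k : ℝ) + 1) ^ 3 + C), ?_, fun z hz => ?_⟩
  · have : 0 ≤ ∑' k : ℕ, 1 / Real.sqrt ((k : ℝ) + 1) ^ 3 := tsum_nonneg fun k => by positivity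
    positivity
  · obtain ⟨hs, hsC⟩ := hC z hz
    have hzm : ∀ m : ℕ, -z ≠ -m := fun m h => by
      have := hz m
      rw [neg_inj.1 h] at this
      norm_num at this
    rw [← (hasSum_polyTerm hp hzm).tsum_eq]
    refine (tsum_of_norm_bounded (((hs0.add hs).mul_left (2 ^ p)).mul_left
      (Real.sqrt (‖z‖ + 1))).hasSum fun k => norm_polyTerm_neg_le hp k (hz k)).trans ?_
    rw [tsum_mul_left, tsum_mul_left, hs0.tsum_add hs, mul_comm]
    gcongr

theorem mem_integerComplement_of_norm {w : ℂ} (h0 : w ≠ 0) (h1 : ‖w‖ < 1) :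
    w ∈ Complex.integerComplement := by
  rintro ⟨n, rfl⟩
  rw [Complex.norm_intCast] at h1
  have h2 : |n| < 1 := by exact_mod_cast h1
  rw [Int.abs_lt_one_iff] at h2
  simp [h2] at h0

/-- The remainder of order `m` of the Laurent expansion of `π cot(π w)` at `0`. -/
def cotRemainder (m : ℕ) (w : ℂ) : ℂ :=
  ∑' n : ℕ, -2 * w ^ (2 * m + 1) / (((n : ℂ) + 1) ^ (2 * m) * (((n : ℂ) + 1) ^ 2 - w ^ 2))

theorem norm_cotRemainder_term_le (m n : ℕ) {w : ℂ} (hw : ‖w‖ ≤ 1 / 2) :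
    ‖-2 * w ^ (2 * m + 1) / (((n : ℂ) + 1) ^ (2 * m) * (((n : ℂ) + 1) ^ 2 - w ^ 2))‖
      ≤ ‖w‖ ^ (2 * m + 1) * (4 * (1 / ((n : ℝ) + 1) ^ 2)) := by
  have hn : ‖(n : ℂ) + 1‖ = n + 1 := by exact_mod_cast Complex.norm_natCast (n + 1)
  have hn1 : (1 : ℝ) ≤ n + 1 := by linarith [Nat.cast_nonneg (α := ℝ) n]
  have h1 : ((n : ℝ) + 1) ^ 2 / 2 ≤ ‖((n : ℂ) + 1) ^ 2 - w ^ 2‖ := by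
    have := norm_sub_norm_le (((n : ℂ) + 1) ^ 2) (w ^ 2)
    rw [norm_pow, norm_pow, hn] at this
    nlinarith [norm_nonneg w]
  rw [norm_div, norm_mul, norm_mul, norm_neg, norm_pow, norm_pow, hn, Complex.norm_ofNat]
  calc 2 * ‖w‖ ^ (2 * m + 1) / (((n : ℝ) + 1) ^ (2 * m) * ‖((n : ℂ) + 1) ^ 2 - w ^ 2‖)
      ≤ 2 * ‖w‖ ^ (2 * m + 1) / (1 * (((n : ℝ) + 1) ^ 2 / 2)) := by
        gcongr
        exact one_le_pow₀ hn1
    _ = _ := by field_simp; ring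

theorem norm_cotRemainder_le (m : ℕ) {w : ℂ} (hw : ‖w‖ ≤ 1 / 2) :
    ‖cotRemainder m w‖ ≤ (4 * ∑' n : ℕ, 1 / ((n : ℝ) + 1) ^ 2) * ‖w‖ ^ (2 * m + 1) := by
  refine (tsum_of_norm_bounded ((summable_inv_succ_sq.mul_left 4).mul_left _).hasSum fun n =>
    norm_cotRemainder_term_le m n hw).trans (le_of_eq ?_)
  rw [tsum_mul_left, tsum_mul_left]
  ring

theorem zetaNat_eq_tsum (m : ℕ) : zetaNat (2 * (m + 1)) = ∑' n : ℕ, 1 / ((n : ℂ) + 1) ^ (2 * (m + 1)) := by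
  rw [zetaNat, if_neg (by omega), zeta_nat_eq_tsum_of_gt_one (by omega),
    ← (summable_one_div_natCast_pow (by omega : 1 < 2 * (m + 1))).sum_add_tsum_nat_add 1]
  simp

/-- One step of the geometric expansion in `w²/(n+1)²`, applied to each term; the pieces split off
sum to a zeta value. -/
theorem cotRemainder_succ (m : ℕ) {w : ℂ} (h0 : w ≠ 0) (hw : ‖w‖ ≤ 1 / 2) :
    cotRemainder m w = -2 * zetaNat (2 * (m + 1)) * w ^ (2 * m + 1) + cotRemainder (m + 1) w := by
  have hs1 : Summable fun n : ℕ => 1 / ((n : ℂ) + 1) ^ (2 * (m + 1)) := by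
    simpa using (summable_nat_add_iff 1).2
      (summable_one_div_natCast_pow (by omega : 1 < 2 * (m + 1)))
  have hs2 : Summable fun n : ℕ => -2 * w ^ (2 * (m + 1) + 1) /
      (((n : ℂ) + 1) ^ (2 * (m + 1)) * (((n : ℂ) + 1) ^ 2 - w ^ 2)) :=
    Summable.of_norm_bounded ((summable_inv_succ_sq.mul_left 4).mul_left _) fun n =>
      norm_cotRemainder_term_le (m + 1) n hw
  rw [zetaNat_eq_tsum, cotRemainder, cotRemainder, mul_right_comm, ← tsum_mul_left,
    ← (hs1.mul_left _).tsum_add hs2]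
  refine tsum_congr fun n => ?_
  have hn : (n : ℂ) + 1 ≠ 0 := Nat.cast_add_one_ne_zero n
  have hne : ((n : ℂ) + 1) ^ 2 - w ^ 2 ≠ 0 := by
    have := Complex.integerComplement_pow_two_ne_pow_two
      (mem_integerComplement_of_norm h0 (by linarith)) (n + 1 : ℤ)
    push_cast at this
    exact sub_ne_zero.2 this.symm
  rw [mul_add, mul_one, pow_add, show 2 * m + 2 + 1 = (2 * m + 1) + 2 by ring, pow_add w]
  field_simp
  ring

/-- The case `m = 0` is the Mittag-Leffler expansion; its polar term `1/w` fits the pattern because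
`-2 ζ(0) = 1`. -/
theorem cot_eq_sum_add_cotRemainder (m : ℕ) {w : ℂ} (h0 : w ≠ 0) (hw : ‖w‖ ≤ 1 / 2) :
    Real.pi * Complex.cot (Real.pi * w) =
      -2 * ∑ k ∈ Finset.range (m + 1), zetaNat (2 * k) * (w ^ (2 * k) * w⁻¹) + cotRemainder m w := by
  have hwc := mem_integerComplement_of_norm h0 (by linarith)
  induction m with
  | zero =>
    have h1 := cot_series_rep' hwc
    rw [sub_eq_iff_eq_add] at h1
    rw [h1, add_comm, cotRemainder]
    simp only [zero_add, Finset.sum_range_one, mul_zero, pow_zero, one_mul, zetaNat_zero, pow_one]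
    congr 1
    · field_simp
    · refine tsum_congr fun n => ?_
      have := cotTerm_identity hwc n
      rw [cotTerm] at this
      rw [this, show ((n : ℂ) + 1) ^ 2 - w ^ 2 = -((w + (n + 1)) * (w - (n + 1))) by ring, div_neg]
      ring
  | succ m ih =>
    rw [ih, Finset.sum_range_succ _ (m + 1), cotRemainder_succ m h0 hw]
    have : w ^ (2 * m + 1) = w ^ (2 * (m + 1)) * w⁻¹ := by
      rw [mul_add, mul_one, show 2 * m + 2 = (2 * m + 1) + 1 by ring, pow_succ w (2 * m + 1)]
      field_simp
    rw [this]
    ring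

theorem cot_pi_mul_sub_intCast (z : ℂ) (n : ℤ) :
    Complex.cot (Real.pi * (z - n)) = Complex.cot (Real.pi * z) := by
  rw [← Complex.tan_inv_eq_cot, ← Complex.tan_inv_eq_cot, mul_sub, mul_comm (Real.pi : ℂ) (n : ℂ),
    Complex.tan_sub_int_mul_pi]

/-- In terms of `q = exp(2πiz)` the cotangent has modulus `|q+1|/|1-q|`, and `|q| ≤ 1/2` here,
giving `(3/2)/(1/2)`. -/
theorem norm_cot_pi_le_of_one_le_im {z : ℂ} (hz : 1 ≤ z.im) :
    ‖Complex.cot (Real.pi * z)‖ ≤ 3 := by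
  set q := Complex.exp (2 * Real.pi * Complex.I * z) with hq
  have hqn : ‖q‖ ≤ 1 / 2 := by
    have h1 : (2 * Real.pi * Complex.I * z).re = -(2 * Real.pi * z.im) := by simp
    rw [hq, Complex.norm_exp, h1, Real.exp_neg, one_div]
    gcongr
    have h2 := Real.add_one_le_exp (2 * Real.pi * z.im)
    have h3 := Real.pi_gt_three
    nlinarith
  have h1 : 1 / 2 ≤ ‖1 - q‖ := by
    have := norm_sub_norm_le 1 q
    rw [norm_one] at this
    linarith
  have h2 : ‖q + 1‖ ≤ 3 / 2 := (norm_add_le _ _).trans (by rw [norm_one]; linarith)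
  rw [Complex.cot_pi_eq_exp_ratio, ← hq, norm_div, norm_mul, Complex.norm_I, one_mul,
    div_le_iff₀ (by linarith)]
  linarith

theorem sin_pi_mul_ne_zero_of_ne_intCast {z : ℂ} (hz : ∀ n : ℤ, z ≠ n) :
    Complex.sin (Real.pi * z) ≠ 0 := by
  refine Complex.sin_ne_zero_iff.2 fun k h => hz k ?_
  rw [mul_comm] at h
  exact mul_right_cancel₀ (Complex.ofReal_ne_zero.2 Real.pi_ne_zero) h

theorem differentiableAt_cot_pi {z : ℂ} (hz : ∀ n : ℤ, z ≠ n) :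
    DifferentiableAt ℂ (fun z => Complex.cot (Real.pi * z)) z := by
  simp only [Complex.cot]
  exact DifferentiableAt.div (by fun_prop) (by fun_prop) (sin_pi_mul_ne_zero_of_ne_intCast hz)

/-- The cotangent is bounded at distance at least `1/2` from its poles. -/
theorem exists_norm_cot_pi_le : ∃ C : ℝ, 0 ≤ C ∧ ∀ z : ℂ, (∀ n : ℤ, 1 / 2 ≤ ‖z - n‖) →
    ‖Complex.cot (Real.pi * z)‖ ≤ C := by
  set K : Set ℂ := (Set.Icc (-1) 1 ×ℂ Set.Icc (-1) 1) ∩ ⋂ n : ℤ, {z | 1 / 2 ≤ ‖z - n‖} with hK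
  have hKc : IsCompact K := (isCompact_Icc.reProdIm isCompact_Icc).inter_right
    (isClosed_iInter fun n => isClosed_le continuous_const (by fun_prop))
  have hcont : ContinuousOn (fun z : ℂ => Complex.cot (Real.pi * z)) K := fun z hz =>
    (differentiableAt_cot_pi fun n h => by
      have := Set.mem_iInter.1 hz.2 n
      simp only [Set.mem_ofPred_eq, h, sub_self, norm_zero] at this
      norm_num at this).continuousAt.continuousWithinAt
  obtain ⟨C, hC⟩ := hKc.exists_bound_of_continuousOn hcont
  refine ⟨max C 3, by positivity, fun z hz => ?_⟩
  rcases le_or_gt 1 z.im with h1 | h1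
  · exact (norm_cot_pi_le_of_one_le_im h1).trans (le_max_right _ _)
  rcases le_or_gt z.im (-1) with h2 | h2
  · have h3 := norm_cot_pi_le_of_one_le_im (z := -z) (by simp; linarith)
    have h4 : Complex.cot (Real.pi * -z) = -Complex.cot (Real.pi * z) := by
      simp [Complex.cot, div_neg]
    rw [h4, norm_neg] at h3
    exact h3.trans (le_max_right _ _)
  · rw [← cot_pi_mul_sub_intCast z ⌊z.re⌋]
    refine (hC _ ⟨?_, Set.mem_iInter.2 fun n => ?_⟩).trans (le_max_left _ _)
    · have h3 := Int.floor_le z.re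
      have h4 := Int.lt_floor_add_one z.re
      rw [Complex.mem_reProdIm, Complex.sub_re, Complex.sub_im, Complex.intCast_re,
        Complex.intCast_im, sub_zero]
      refine ⟨⟨?_, ?_⟩, h2.le, h1.le⟩ <;> linarith
    · have := hz (⌊z.re⌋ + n)
      push_cast at this
      rwa [← sub_sub] at this

/-! ### Decay of the rational function and residues of the kernel -/

theorem mem_poles {r : RatFunc ℂ} {z : ℂ} : z ∈ poles r ↔ r.denom.eval z = 0 := by
  rw [poles, Multiset.mem_toFinset, Polynomial.mem_roots r.denom_ne_zero, Polynomial.IsRoot]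

theorem ratEval_eq_div (r : RatFunc ℂ) :
    ratEval r = fun z => r.num.eval z / r.denom.eval z := rfl

theorem analyticAt_eval (P : Polynomial ℂ) (z : ℂ) : AnalyticAt ℂ (fun z => P.eval z) z :=
  P.differentiable.analyticAt z

theorem analyticAt_ratEval {r : RatFunc ℂ} {z : ℂ} (hz : z ∉ poles r) :
    AnalyticAt ℂ (ratEval r) z := by
  rw [ratEval_eq_div]
  exact (analyticAt_eval _ z).div (analyticAt_eval _ z) fun h => hz (mem_poles.2 h)

theorem meromorphicAt_ratEval (r : RatFunc ℂ) (z : ℂ) : MeromorphicAt (ratEval r) z := by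
  rw [ratEval_eq_div]
  exact (analyticAt_eval _ z).meromorphicAt.div (analyticAt_eval _ z).meromorphicAt

theorem exists_norm_ratEval_le {r : RatFunc ℂ}
    (hr : (fun z : ℂ => ratEval r z) =O[Bornology.cobounded ℂ] fun z : ℂ => z ^ (-2 : ℤ)) :
    ∃ A R : ℝ, 0 ≤ A ∧ 1 ≤ R ∧ (∀ β ∈ poles r, ‖β‖ < R) ∧
      ∀ z : ℂ, R ≤ ‖z‖ → ‖ratEval r z‖ ≤ A / ‖z‖ ^ 2 := by
  obtain ⟨A, hA, h⟩ := hr.exists_nonneg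
  rw [IsBigOWith, ← comap_norm_atTop, eventually_comap, eventually_atTop] at h
  obtain ⟨R₁, hR₁⟩ := h
  obtain ⟨R₂, hR₂⟩ := (poles r).finite_toSet.isBounded.exists_norm_le
  refine ⟨A, max (max R₁ (R₂ + 1)) 1, hA, le_max_right _ _, fun β hβ => ?_, fun z hz => ?_⟩
  · have h1 := hR₂ β hβ
    have h2 : R₂ + 1 ≤ max (max R₁ (R₂ + 1)) 1 := le_max_of_le_left (le_max_right _ _)
    linarith
  · have := hR₁ ‖z‖ ((le_max_of_le_left (le_max_left _ _)).trans hz) z rfl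
    rwa [norm_zpow, zpow_neg, ← div_eq_mul_inv] at this

/-- Cauchy's estimate on the unit circle about `n`. The constant `16` comes from `‖z‖ ≥ n - 1 ≥
(n+1)/4` on that circle. -/
theorem exists_norm_iteratedDeriv_ratEval_le {r : RatFunc ℂ}
    (hr : (fun z : ℂ => ratEval r z) =O[Bornology.cobounded ℂ] fun z : ℂ => z ^ (-2 : ℤ)) (j : ℕ) :
    ∃ A : ℝ, 0 ≤ A ∧ ∀ᶠ n : ℕ in atTop,
      ‖iteratedDeriv j (ratEval r) n‖ ≤ A * (1 / ((n : ℝ) + 1) ^ 2) := by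
  obtain ⟨A, R, hA, hR1, hpoles, hdecay⟩ := exists_norm_ratEval_le hr
  refine ⟨j.factorial * (16 * A), by positivity, ?_⟩
  filter_upwards [eventually_ge_atTop (⌈R⌉₊ + 2)] with n hn
  have hnR : R + 2 ≤ n := by
    have h1 := Nat.le_ceil R
    have h2 : ((⌈R⌉₊ + 2 : ℕ) : ℝ) ≤ n := Nat.cast_le.2 hn
    push_cast at h2
    linarith
  have hball : ∀ z ∈ Metric.closedBall (n : ℂ) 1, (n : ℝ) - 1 ≤ ‖z‖ := fun z hz => by
    have h1 : ‖z - n‖ ≤ 1 := by simpa [dist_eq_norm] using hz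
    have h2 := norm_sub_norm_le (n : ℂ) z
    rw [Complex.norm_natCast, norm_sub_rev] at h2
    linarith
  have hd : DiffContOnCl ℂ (ratEval r) (Metric.ball (n : ℂ) 1) := by
    refine DifferentiableOn.diffContOnCl fun z hz => ?_
    rw [closure_ball _ one_ne_zero] at hz
    refine (analyticAt_ratEval fun h => ?_).differentiableAt.differentiableWithinAt
    have h1 := hball z hz
    have h2 := hpoles z h
    linarith
  have h := Complex.norm_iteratedDeriv_le_of_forall_mem_sphere_norm_le j one_pos hd
    (C := 16 * A * (1 / ((n : ℝ) + 1) ^ 2)) fun z hz => ?_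
  · rw [one_pow, div_one] at h
    linarith
  · have h1 := hball z (Metric.sphere_subset_closedBall hz)
    have h2 : ((n : ℝ) + 1) / 4 ≤ ‖z‖ := by linarith
    refine (hdecay z (by linarith)).trans ?_
    calc A / ‖z‖ ^ 2 ≤ A / (((n : ℝ) + 1) / 4) ^ 2 := by gcongr
      _ = _ := by field_simp; ring

theorem summable_iteratedDeriv_ratEval {r : RatFunc ℂ}
    (hr : (fun z : ℂ => ratEval r z) =O[Bornology.cobounded ℂ] fun z : ℂ => z ^ (-2 : ℤ)) (j : ℕ) :
    Summable fun n : ℕ => iteratedDeriv j (ratEval r) (n : ℂ) := by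
  obtain ⟨A, -, h⟩ := exists_norm_iteratedDeriv_ratEval_le hr j
  exact Summable.of_norm_bounded_eventually_nat (summable_inv_succ_sq.mul_left A) h

/-- Telescoping `1/(n+1) ≤ 2(√(n+1) - √n)`. Any growth below order `n` would do against `n⁻²`; the
square root avoids logarithms. -/
theorem norm_genHarmonic_le {p : ℕ} (hp : 1 ≤ p) (n : ℕ) :
    ‖genHarmonic p n‖ ≤ 2 * Real.sqrt n := by
  rw [genHarmonic_eq_sum_range]
  induction n with
  | zero => simp
  | succ n ih =>
    rw [Finset.sum_range_succ]
    refine (norm_add_le _ _).trans ?_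
    set a := Real.sqrt n with ha
    set b := Real.sqrt ((n + 1 : ℕ) : ℝ) with hb
    have ha0 : 0 ≤ a := Real.sqrt_nonneg _
    have ha2 : a ^ 2 = n := Real.sq_sqrt (Nat.cast_nonneg n)
    have hb2 : b ^ 2 = (n : ℝ) + 1 := by rw [hb, Real.sq_sqrt (by positivity)]; push_cast; ring
    have hb1 : 1 ≤ b := Real.one_le_sqrt.2 (by push_cast; linarith [Nat.cast_nonneg (α := ℝ) n])
    have hab : a ≤ b := Real.sqrt_le_sqrt (by push_cast; linarith)
    have h1 : ‖1 / ((n : ℂ) + 1) ^ p‖ ≤ 1 / b ^ 2 := by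
      have hn : ‖(n : ℂ) + 1‖ = n + 1 := by exact_mod_cast Complex.norm_natCast (n + 1)
      rw [norm_div, norm_one, norm_pow, hn, ← hb2]
      gcongr
      exact le_self_pow₀ (one_le_pow₀ hb1) (by omega)
    have h2 : 1 / b ^ 2 ≤ 2 * (b - a) := by
      rw [div_le_iff₀ (by positivity)]
      have h3 : (b - a) * (b + a) = 1 := by linear_combination hb2 - ha2
      have h4 : (b - a) * (b + a) ≤ (b - a) * (2 * b) := by
        gcongr
        linarith
      have h5 : (b - a) * (2 * b) ≤ 2 * (b - a) * b ^ 2 := by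
        nlinarith [mul_nonneg (sub_nonneg.2 hab) (mul_nonneg (sub_nonneg.2 hb1) (by linarith : 0 ≤ b))]
      linarith
    linarith

theorem summable_mul_of_norm_le {h g : ℕ → ℂ} {A B : ℝ}
    (hh : ∀ n : ℕ, ‖h n‖ ≤ B * Real.sqrt ((n : ℝ) + 1))
    (hg : ∀ᶠ n : ℕ in atTop, ‖g n‖ ≤ A * (1 / ((n : ℝ) + 1) ^ 2)) :
    Summable fun n => h n * g n := by
  have hs : Summable fun k : ℕ => 1 / Real.sqrt ((k : ℝ) + 1) ^ 3 := by
    refine (summable_inv_sqrt_pow_three.comp_injective Nat.cast_injective).congr fun n => ?_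
    simp
  refine Summable.of_norm_bounded_eventually_nat (hs.mul_left (B * A)) ?_
  filter_upwards [hg] with n hn
  have h0 : 0 < Real.sqrt ((n : ℝ) + 1) := Real.sqrt_pos.2 (by positivity)
  have h2 : ((n : ℝ) + 1) = Real.sqrt ((n : ℝ) + 1) ^ 2 := (Real.sq_sqrt (by positivity)).symm
  calc ‖h n * g n‖ ≤ (B * Real.sqrt ((n : ℝ) + 1)) * (A * (1 / ((n : ℝ) + 1) ^ 2)) := by
        rw [norm_mul]
        exact mul_le_mul (hh n) hn (norm_nonneg _) ((norm_nonneg _).trans (hh n))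
    _ = _ := by
      set s := Real.sqrt ((n : ℝ) + 1)
      rw [h2]
      field_simp

theorem norm_add_genHarmonic_le {p : ℕ} (hp : 1 ≤ p) (c : ℂ) {e : ℂ} (he : ‖e‖ = 1) (n : ℕ) :
    ‖c + e * genHarmonic p n‖ ≤ (‖c‖ + 2) * Real.sqrt ((n : ℝ) + 1) := by
  have h1 := norm_genHarmonic_le hp n
  have h2 : Real.sqrt n ≤ Real.sqrt ((n : ℝ) + 1) := Real.sqrt_le_sqrt (by linarith)
  have h3 : 1 ≤ Real.sqrt ((n : ℝ) + 1) :=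
    Real.one_le_sqrt.2 (by linarith [Nat.cast_nonneg (α := ℝ) n])
  have h4 : ‖c + e * genHarmonic p n‖ ≤ ‖c‖ + ‖genHarmonic p n‖ :=
    (norm_add_le _ _).trans (by rw [norm_mul, he, one_mul])
  nlinarith [norm_nonneg c]

theorem summable_genHarmonic_mul_ratEval {p : ℕ} (hp : 1 ≤ p) {r : RatFunc ℂ}
    (hr : (fun z : ℂ => ratEval r z) =O[Bornology.cobounded ℂ] fun z : ℂ => z ^ (-2 : ℤ)) (c : ℂ) :
    Summable fun n : ℕ => (c + genHarmonic p n) * ratEval r (n : ℂ) := by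
  obtain ⟨A, -, h⟩ := exists_norm_iteratedDeriv_ratEval_le hr 0
  simp only [iteratedDeriv_zero] at h
  exact summable_mul_of_norm_le
    (fun n => by simpa using norm_add_genHarmonic_le hp c norm_one n) h

theorem summable_genHarmonic_mul_ratEval_neg {p : ℕ} (hp : 1 ≤ p) {r : RatFunc ℂ}
    (hr : (fun z : ℂ => ratEval r z) =O[Bornology.cobounded ℂ] fun z : ℂ => z ^ (-2 : ℤ)) (c : ℂ) :
    Summable fun n : ℕ => (c - genHarmonic p n) * ratEval r (-((n : ℂ) + 1)) := by
  obtain ⟨A, R, hA, -, -, hdecay⟩ := exists_norm_ratEval_le hr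
  refine summable_mul_of_norm_le (A := A)
    (fun n => by simpa [sub_eq_add_neg] using
      norm_add_genHarmonic_le hp c (e := -1) (by simp) n) ?_
  filter_upwards [eventually_ge_atTop ⌈R⌉₊] with n hn
  have hnn : ‖-((n : ℂ) + 1)‖ = n + 1 := by
    rw [norm_neg]; exact_mod_cast Complex.norm_natCast (n + 1)
  have := hdecay (-((n : ℂ) + 1)) (by rw [hnn]; linarith [Nat.ceil_le.1 hn])
  rwa [hnn, ← mul_one_div] at this

theorem kernelFun_eq (p : ℕ) (r : RatFunc ℂ) (z : ℂ) :
    kernelFun p r z =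
      Real.pi * Complex.cot (Real.pi * z) * (scaledPolygamma p (-z) * ratEval r z) := by
  rw [kernelFun, scaledPolygamma]
  ring

theorem differentiableAt_scaledPolygamma_neg {p : ℕ} (hp : 1 ≤ p) {z : ℂ} (hz : ∀ m : ℕ, z ≠ m) :
    DifferentiableAt ℂ (fun z => scaledPolygamma p (-z)) z :=
  (differentiableAt_scaledPolygamma hp fun m h => hz m (neg_inj.1 h)).comp z
    (f := fun z : ℂ => -z) (by fun_prop)

theorem differentiableAt_kernelFun {p : ℕ} (hp : 1 ≤ p) {r : RatFunc ℂ} {z : ℂ}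
    (hz : ∀ n : ℤ, z ≠ n) (hzr : z ∉ poles r) : DifferentiableAt ℂ (kernelFun p r) z := by
  rw [funext (kernelFun_eq p r)]
  exact ((differentiableAt_cot_pi hz).const_mul _).mul
    ((differentiableAt_scaledPolygamma_neg hp fun m => by exact_mod_cast hz m).mul
      (analyticAt_ratEval hzr).differentiableAt)

theorem eventually_ne_intCast (c : ℂ) : ∀ᶠ z : ℂ in 𝓝[≠] c, ∀ n : ℤ, z ≠ n := by
  by_cases hc : c ∈ Complex.integerComplement
  · filter_upwards [nhdsWithin_le_nhds (Complex.isOpen_compl_range_intCast.mem_nhds hc)] with z hz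
    rintro n rfl
    exact hz ⟨n, rfl⟩
  · obtain ⟨m, rfl⟩ := not_not.1 hc
    filter_upwards [self_mem_nhdsWithin,
      nhdsWithin_le_nhds (Metric.ball_mem_nhds (m : ℂ) one_pos)] with z hz hz1
    rintro n rfl
    have h1 : ((n : ℂ) - m) ∈ Complex.integerComplement :=
      mem_integerComplement_of_norm (sub_ne_zero.2 hz) (by simpa [dist_eq_norm] using hz1)
    exact h1 ⟨n - m, by push_cast; rfl⟩

theorem eventually_differentiableAt_kernelFun {p : ℕ} (hp : 1 ≤ p) (r : RatFunc ℂ) (c : ℂ) :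
    ∀ᶠ z in 𝓝[≠] c, DifferentiableAt ℂ (kernelFun p r) z := by
  have h1 : ∀ᶠ z in 𝓝[≠] c, z ∉ (poles r).erase c :=
    nhdsWithin_le_nhds (((poles r).erase c).finite_toSet.isClosed.isOpen_compl.mem_nhds (by simp))
  filter_upwards [h1, eventually_ne_intCast c, self_mem_nhdsWithin] with z hz hzn hzc
  refine differentiableAt_kernelFun hp hzn fun h => hz (Finset.mem_erase.2 ⟨hzc, h⟩)

theorem isBigO_cotRemainder (n : ℤ) (m : ℕ) :
    (fun z => cotRemainder m (z - n)) =O[𝓝[≠] (n : ℂ)] fun z => (z - n) ^ (2 * m + 1) := by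
  refine IsBigO.of_bound (4 * ∑' n : ℕ, 1 / ((n : ℝ) + 1) ^ 2) ?_
  filter_upwards [nhdsWithin_le_nhds (Metric.ball_mem_nhds (n : ℂ) one_half_pos)] with z hz
  rw [norm_pow]
  exact norm_cotRemainder_le m (by simpa [dist_eq_norm] using (Metric.mem_ball.1 hz).le)

theorem eventually_cot_eq (n : ℤ) (m : ℕ) : ∀ᶠ z in 𝓝[≠] (n : ℂ),
    Real.pi * Complex.cot (Real.pi * z) =
      -2 * ∑ k ∈ Finset.range (m + 1), zetaNat (2 * k) * ((z - n) ^ (2 * k) * (z - n)⁻¹)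
        + cotRemainder m (z - n) := by
  filter_upwards [self_mem_nhdsWithin,
    nhdsWithin_le_nhds (Metric.ball_mem_nhds (n : ℂ) one_half_pos)] with z hz hz1
  rw [← cot_pi_mul_sub_intCast z n]
  exact cot_eq_sum_add_cotRemainder m (sub_ne_zero.2 hz)
    (by simpa [dist_eq_norm] using (Metric.mem_ball.1 hz1).le)

theorem isBigO_one_sub_pow (c : ℂ) (m : ℕ) :
    (fun z => (z - c) ^ m) =O[𝓝[≠] c] fun _ => (1 : ℂ) := by
  have h : ContinuousAt (fun z : ℂ => (z - c) ^ m) c := by fun_prop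
  exact (h.isBigO_one ℂ).mono nhdsWithin_le_nhds

theorem hasRes_inv_mul {g : ℂ → ℂ} {c : ℂ} (hg : DifferentiableAt ℂ g c) :
    HasRes (fun z => (z - c)⁻¹ * g z) c (g c) := by
  refine ⟨Polynomial.C (g c), by simp, ?_⟩
  have h := (isBigO_refl (fun z => (z - c)⁻¹) (𝓝[≠] c)).mul
    (hg.isBigO_sub.mono nhdsWithin_le_nhds)
  refine h.congr' ?_ ?_
  · exact Eventually.of_forall fun z => by simp only [Polynomial.eval_C]; ring
  · filter_upwards [self_mem_nhdsWithin] with z hz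
    exact inv_mul_cancel₀ (sub_ne_zero.2 hz)

theorem hasRes_cot_mul {g : ℂ → ℂ} (n : ℤ) (hg : DifferentiableAt ℂ g n) :
    HasRes (fun z => Real.pi * Complex.cot (Real.pi * z) * g z) n (g n) := by
  have h1 : (fun z => cotRemainder 0 (z - n) * g z) =O[𝓝[≠] (n : ℂ)] fun _ => (1 : ℂ) := by
    have := ((isBigO_cotRemainder n 0).trans (isBigO_one_sub_pow _ _)).mul
      ((hg.continuousAt.isBigO_one ℂ).mono nhdsWithin_le_nhds)
    simpa using this
  have h2 := (hasRes_inv_mul hg).add (hasRes_of_isBigO_one h1)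
  rw [add_zero] at h2
  refine h2.congr ?_
  filter_upwards [eventually_cot_eq n 0] with z hz
  rw [hz]
  simp [zetaNat_zero]
  ring

/-- The `k`-th term of the cotangent expansion lowers the pole order to `p-2k+1`, so it extracts the
Taylor coefficient of `g` of order `p-2k`. -/
theorem hasRes_cot_mul_inv_pow {g : ℂ → ℂ} (n : ℤ) (p : ℕ) (hg : AnalyticAt ℂ g n) :
    HasRes (fun z => Real.pi * Complex.cot (Real.pi * z) * ((z - n)⁻¹ ^ p * g z)) n
      (-2 * ∑ k ∈ Finset.range (p / 2 + 1),
        zetaNat (2 * k) * (iteratedDeriv (p - 2 * k) g n / (p - 2 * k).factorial)) := by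
  have h1 : (fun z => cotRemainder (p / 2) (z - n) * ((z - n)⁻¹ ^ p * g z))
      =O[𝓝[≠] (n : ℂ)] fun _ => (1 : ℂ) := by
    have h := (isBigO_cotRemainder n (p / 2)).mul
      ((isBigO_refl (fun z : ℂ => (z - n)⁻¹ ^ p) (𝓝[≠] (n : ℂ))).mul
        ((hg.continuousAt.isBigO_one ℂ).mono nhdsWithin_le_nhds))
    refine (h.congr' .rfl ?_).trans (isBigO_one_sub_pow n (2 * (p / 2) + 1 - p))
    filter_upwards [self_mem_nhdsWithin] with z hz
    have hz' : z - n ≠ 0 := sub_ne_zero.2 hz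
    -- Truncating at `⌊p/2⌋` suffices: the remainder vanishes to order `2⌊p/2⌋ + 1 ≥ p`, enough to
    -- cancel `(z-n)^(-p)`.
    obtain ⟨q, hq⟩ := Nat.exists_eq_add_of_le (show p ≤ 2 * (p / 2) + 1 by omega)
    rw [hq, Nat.add_sub_cancel_left, pow_add, mul_one, inv_pow]
    field_simp
  have h2 := ((HasRes.sum (Finset.range (p / 2 + 1)) fun k _ =>
    (hasRes_inv_pow_mul hg (p - 2 * k)).const_mul (zetaNat (2 * k))).const_mul (-2)).add
      (hasRes_of_isBigO_one h1)
  rw [add_zero] at h2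
  refine h2.congr ?_
  filter_upwards [eventually_cot_eq n (p / 2), self_mem_nhdsWithin] with z hz hzn
  have hz' : z - n ≠ 0 := sub_ne_zero.2 hzn
  rw [hz, add_mul]
  congr 1
  rw [mul_assoc, Finset.sum_mul]
  congr 1
  refine Finset.sum_congr rfl fun k hk => ?_
  have hk' : 2 * k ≤ p := by
    have := Finset.mem_range.1 hk
    omega
  obtain ⟨q, hq⟩ := Nat.exists_eq_add_of_le hk'
  rw [hq, Nat.add_sub_cancel_left, pow_add _ (2 * k) q, pow_succ, inv_pow, inv_pow]
  field_simp

theorem hasRes_kernelFun_natCast {p : ℕ} (hp : 1 ≤ p) {r : RatFunc ℂ} (n : ℕ)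
    (hn : (n : ℂ) ∉ poles r) :
    HasRes (kernelFun p r) n
      (-2 * ∑ k ∈ Finset.range (p / 2 + 1), zetaNat (2 * k) *
          (iteratedDeriv (p - 2 * k) (ratEval r) n / (p - 2 * k).factorial)
        + ((-1) ^ p * zetaNat p + genHarmonic p n) * ratEval r n) := by
  have hr := analyticAt_ratEval hn
  have h1 := hasRes_cot_mul_inv_pow (n : ℤ) p (g := ratEval r) (by exact_mod_cast hr)
  have h2 := hasRes_cot_mul (n : ℤ) (g := fun z => regularPart p n z * ratEval r z)
    (by exact_mod_cast (differentiableAt_regularPart hp n).mul hr.differentiableAt)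
  have h3 := h1.add h2
  rw [Int.cast_natCast, regularPart_self hp] at h3
  refine h3.congr ?_
  filter_upwards [eventually_ne_intCast n] with z hz
  rw [kernelFun_eq, scaledPolygamma_neg_eq hp n fun m => by exact_mod_cast hz m]
  ring

theorem neg_natCast_succ_ne_natCast (n m : ℕ) : -((n : ℂ) + 1) ≠ m := fun h => by
  have h1 : ((n + 1 + m : ℕ) : ℂ) = 0 := by push_cast; linear_combination -h
  exact absurd (Nat.cast_eq_zero.1 h1) (by omega)

theorem hasRes_kernelFun_neg {p : ℕ} (hp : 1 ≤ p) {r : RatFunc ℂ} (n : ℕ)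
    (hn : -((n : ℂ) + 1) ∉ poles r) :
    HasRes (kernelFun p r) (-((n : ℂ) + 1))
      ((-1) ^ p * ((zetaNat p - genHarmonic p n) * ratEval r (-((n : ℂ) + 1)))) := by
  have h0 : ((-((n : ℤ) + 1) : ℤ) : ℂ) = -((n : ℂ) + 1) := by push_cast; ring
  have h1 := hasRes_cot_mul (-((n : ℤ) + 1)) (g := fun z => scaledPolygamma p (-z) * ratEval r z)
    (by rw [h0]; exact (differentiableAt_scaledPolygamma_neg hp
          (neg_natCast_succ_ne_natCast n)).mul
          (analyticAt_ratEval hn).differentiableAt)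
  rw [h0, neg_neg, scaledPolygamma_natCast_add_one hp, mul_assoc] at h1
  rwa [← funext (kernelFun_eq p r)] at h1

/-- Away from the integers the kernel is an analytic function times a rational one, hence
meromorphic. Existence is enough, since these residues stay unevaluated in the final formula. -/
theorem exists_hasRes_kernelFun {p : ℕ} (hp : 1 ≤ p) (r : RatFunc ℂ) {c : ℂ}
    (hc : ∀ n : ℤ, c ≠ n) : ∃ a, HasRes (kernelFun p r) c a := by
  refine MeromorphicAt.exists_hasRes ?_
  have h : AnalyticAt ℂ (fun z => Real.pi * Complex.cot (Real.pi * z) * scaledPolygamma p (-z)) c := by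
    rw [Complex.analyticAt_iff_eventually_differentiableAt]
    have hopen : ∀ᶠ z : ℂ in 𝓝 c, ∀ n : ℤ, z ≠ n := by
      rw [← nhdsNE_sup_pure, eventually_sup]
      exact ⟨eventually_ne_intCast c, hc⟩
    filter_upwards [hopen] with z hz
    exact ((differentiableAt_cot_pi hz).const_mul _).mul
      (differentiableAt_scaledPolygamma_neg hp fun m => by exact_mod_cast hz m)
  have h2 := h.meromorphicAt.mul (meromorphicAt_ratEval r c)
  refine h2.congr (Eventually.of_forall fun z => ?_)
  rw [kernelFun_eq, ← mul_assoc]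
  rfl

/-! ### The contour integral -/

/-- The integers in `[-N, N]` together with the poles of `r`. -/
def enclosedPoles (r : RatFunc ℂ) (N : ℕ) : Finset ℂ :=
  poles r ∪ ((Finset.range (N + 1)).image (fun n : ℕ => (n : ℂ)) ∪
    (Finset.range N).image fun n : ℕ => -((n : ℂ) + 1))

theorem sum_enclosedPoles {r : RatFunc ℂ} (hint : ∀ n : ℤ, (n : ℂ) ∉ poles r) (N : ℕ) (a : ℂ → ℂ) :
    ∑ c ∈ enclosedPoles r N, a c = ∑ β ∈ poles r, a β +
      (∑ n ∈ Finset.range (N + 1), a n + ∑ n ∈ Finset.range N, a (-((n : ℂ) + 1))) := by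
  rw [enclosedPoles, Finset.sum_union, Finset.sum_union, Finset.sum_image, Finset.sum_image]
  · intro x _ y _ h
    have : (x : ℂ) = y := by linear_combination -h
    exact_mod_cast this
  · exact fun x _ y _ h => Nat.cast_injective h
  · rw [Finset.disjoint_left]
    intro c h1 h2
    obtain ⟨m, -, rfl⟩ := Finset.mem_image.1 h1
    obtain ⟨n, -, h⟩ := Finset.mem_image.1 h2
    exact neg_natCast_succ_ne_natCast n m h
  · rw [Finset.disjoint_left]
    intro c h1 h2
    rcases Finset.mem_union.1 h2 with h2 | h2
    · obtain ⟨m, -, rfl⟩ := Finset.mem_image.1 h2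
      exact hint m (by exact_mod_cast h1)
    · obtain ⟨m, -, rfl⟩ := Finset.mem_image.1 h2
      exact hint (-(m + 1)) (by push_cast; exact h1)

theorem intCast_mem_enclosedPoles (r : RatFunc ℂ) {N : ℕ} {n : ℤ} (hn : |n| ≤ N) :
    (n : ℂ) ∈ enclosedPoles r N := by
  rw [enclosedPoles, Finset.mem_union, Finset.mem_union, Finset.mem_image, Finset.mem_image]
  right
  rcases le_or_gt 0 n with h | h
  · left
    obtain ⟨m, rfl⟩ := Int.eq_ofNat_of_zero_le h
    refine ⟨m, ?_, by simp⟩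
    rw [Finset.mem_range]
    have := le_abs_self (m : ℤ)
    omega
  · right
    obtain ⟨m, hm⟩ := Int.eq_ofNat_of_zero_le (show 0 ≤ -n - 1 by omega)
    refine ⟨m, ?_, ?_⟩
    · rw [Finset.mem_range]
      have := neg_le_abs n
      omega
    · rw [show n = -(m + 1) by omega]
      push_cast
      ring

theorem norm_lt_of_mem_enclosedPoles {r : RatFunc ℂ} {N : ℕ} (hN : ∀ β ∈ poles r, ‖β‖ < N)
    {c : ℂ} (hc : c ∈ enclosedPoles r N) : ‖c‖ < N + 1 / 2 := by
  rw [enclosedPoles, Finset.mem_union, Finset.mem_union, Finset.mem_image, Finset.mem_image] at hc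
  rcases hc with hc | ⟨n, hn, rfl⟩ | ⟨n, hn, rfl⟩
  · linarith [hN c hc]
  · have : (n : ℝ) ≤ N := Nat.cast_le.2 (Nat.lt_succ_iff.1 (Finset.mem_range.1 hn))
    rw [Complex.norm_natCast]
    linarith
  · have h1 : ((n + 1 : ℕ) : ℝ) ≤ N := Nat.cast_le.2 (Finset.mem_range.1 hn)
    have h2 : ‖-((n : ℂ) + 1)‖ = ((n + 1 : ℕ) : ℝ) := by
      rw [norm_neg, ← Complex.norm_natCast]; push_cast; rfl
    rw [h2]
    linarith

/-- `|n|` is an integer and `‖z‖` a half-integer, so the reverse triangle inequality suffices. -/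
theorem half_le_norm_sub_intCast {z : ℂ} {N : ℕ} (hz : ‖z‖ = N + 1 / 2) (n : ℤ) :
    1 / 2 ≤ ‖z - n‖ := by
  have h1 := norm_sub_norm_le z n
  have h2 := norm_sub_norm_le (n : ℂ) z
  rw [norm_sub_rev (n : ℂ) z] at h2
  rw [Complex.norm_intCast, hz] at h1 h2
  rw [← Int.cast_abs] at h1 h2
  rcases le_or_gt |n| N with h | h
  · have : ((|n| : ℤ) : ℝ) ≤ N := by exact_mod_cast h
    linarith
  · have : (N : ℝ) + 1 ≤ ((|n| : ℤ) : ℝ) := by exact_mod_cast h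
    linarith

theorem hasRes_residue_kernelFun {p : ℕ} (hp : 1 ≤ p) {r : RatFunc ℂ}
    (hint : ∀ n : ℤ, (n : ℂ) ∉ poles r) {N : ℕ} {c : ℂ} (hc : c ∈ enclosedPoles r N) :
    HasRes (kernelFun p r) c (residue (kernelFun p r) c) := by
  have key : ∀ {a}, HasRes (kernelFun p r) c a →
      HasRes (kernelFun p r) c (residue (kernelFun p r) c) := fun h => by
    rwa [residue_eq_of_hasRes (eventually_differentiableAt_kernelFun hp r c) h]
  rw [enclosedPoles, Finset.mem_union, Finset.mem_union, Finset.mem_image, Finset.mem_image] at hc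
  rcases hc with hc | ⟨n, -, rfl⟩ | ⟨n, -, rfl⟩
  · obtain ⟨a, ha⟩ := exists_hasRes_kernelFun hp r (c := c) fun n h => hint n (h ▸ hc)
    exact key ha
  · exact key (hasRes_kernelFun_natCast hp n (by exact_mod_cast hint n))
  · exact key (hasRes_kernelFun_neg hp n (by exact_mod_cast hint (-(n + 1))))

theorem tendsto_circleIntegral_kernelFun {p : ℕ} (hp : 1 ≤ p) {r : RatFunc ℂ}
    (hr : (fun z : ℂ => ratEval r z) =O[Bornology.cobounded ℂ] fun z : ℂ => z ^ (-2 : ℤ)) :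
    Tendsto (fun N : ℕ => ∮ z in C(0, (N : ℝ) + 1 / 2), kernelFun p r z) atTop (𝓝 0) := by
  obtain ⟨C₁, hC₁, hcot⟩ := exists_norm_cot_pi_le
  obtain ⟨C₂, hC₂, hpsi⟩ := exists_norm_scaledPolygamma_le hp
  obtain ⟨A, R₀, hA, -, -, hdecay⟩ := exists_norm_ratEval_le hr
  set K : ℝ := 2 * Real.pi * (Real.pi * C₁ * (C₂ * A)) with hK
  have hlim : Tendsto (fun N : ℕ => K * (2 / Real.sqrt ((N : ℝ) + 1 / 2))) atTop (𝓝 0) := by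
    have h1 : Tendsto (fun N : ℕ => Real.sqrt ((N : ℝ) + 1 / 2)) atTop atTop :=
      Real.tendsto_sqrt_atTop.comp
        (tendsto_atTop_add_const_right _ _ tendsto_natCast_atTop_atTop)
    simpa using (h1.const_div_atTop 2).const_mul K
  refine squeeze_zero_norm' ?_ hlim
  filter_upwards [eventually_ge_atTop (max ⌈R₀⌉₊ 1)] with N hN
  have hNR : R₀ ≤ N := Nat.ceil_le.1 ((le_max_left _ _).trans hN)
  have hN1 : (1 : ℝ) ≤ N := Nat.one_le_cast.2 ((le_max_right _ _).trans hN)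
  set R : ℝ := (N : ℝ) + 1 / 2 with hR
  have hRpos : 0 < R := by positivity
  have hbound : ∀ z ∈ Metric.sphere (0 : ℂ) R,
      ‖kernelFun p r z‖ ≤ Real.pi * C₁ * (C₂ * Real.sqrt (R + 1) * (A / R ^ 2)) := fun z hz => by
    have hzR : ‖z‖ = R := by simpa using hz
    have hzn := half_le_norm_sub_intCast hzR
    have h1 := hcot z hzn
    have h2 := hpsi z hzn
    have h3 := hdecay z (by rw [hzR]; linarith)
    rw [hzR] at h2 h3
    rw [kernelFun_eq, norm_mul, norm_mul, norm_mul, Complex.norm_real,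
      Real.norm_of_nonneg Real.pi_pos.le]
    gcongr
  refine (circleIntegral.norm_integral_le_of_norm_le_const hRpos.le hbound).trans ?_
  have hs : Real.sqrt (R + 1) ≤ 2 * Real.sqrt R := by
    rw [Real.sqrt_le_left (by positivity), mul_pow, Real.sq_sqrt hRpos.le]
    linarith
  have hsR : Real.sqrt R ^ 2 = R := Real.sq_sqrt hRpos.le
  have hsp : 0 < Real.sqrt R := Real.sqrt_pos.2 hRpos
  calc 2 * Real.pi * R * (Real.pi * C₁ * (C₂ * Real.sqrt (R + 1) * (A / R ^ 2)))
      = K * (Real.sqrt (R + 1) / R) := by rw [hK]; field_simp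
    _ ≤ K * (2 * Real.sqrt R / R) := by
      have : 0 ≤ K := by positivity
      gcongr
    _ = K * (2 / Real.sqrt R) := by
      congr 1
      nth_rewrite 2 [← hsR]
      field_simp

end ParametricEuler
end

/-! ### The summation formula -/

theorem mainTheorem2 (p : ℕ) (hp : 1 ≤ p) (r : RatFunc ℂ)
    (hr : (fun z : ℂ => ParametricEuler.ratEval r z)
      =O[Bornology.cobounded ℂ] fun z : ℂ => z ^ (-2 : ℤ))
    (hint : ∀ n : ℤ, (n : ℂ) ∉ ParametricEuler.poles r) :
    (Summable fun n : ℕ =>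
      ((-1) ^ p * ParametricEuler.zetaNat p + ParametricEuler.genHarmonic p n)
        * ParametricEuler.ratEval r (n : ℂ)) ∧
    (Summable fun n : ℕ =>
      (ParametricEuler.zetaNat p - ParametricEuler.genHarmonic p n)
        * ParametricEuler.ratEval r (-((n : ℂ) + 1))) ∧
    (∀ k ∈ Finset.range (p / 2 + 1), Summable fun n : ℕ =>
      iteratedDeriv (p - 2 * k) (ParametricEuler.ratEval r) (n : ℂ)) ∧
    (∑' n : ℕ, ((-1) ^ p * ParametricEuler.zetaNat p + ParametricEuler.genHarmonic p n)
        * ParametricEuler.ratEval r (n : ℂ))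
      + (-1) ^ p * (∑' n : ℕ, (ParametricEuler.zetaNat p - ParametricEuler.genHarmonic p n)
        * ParametricEuler.ratEval r (-((n : ℂ) + 1)))
      - 2 * (∑ k ∈ Finset.range (p / 2 + 1),
          1 / ((p - 2 * k).factorial : ℂ) * ParametricEuler.zetaNat (2 * k)
            * ∑' n : ℕ, iteratedDeriv (p - 2 * k) (ParametricEuler.ratEval r) (n : ℂ))
      + (∑ β ∈ ParametricEuler.poles r,
          ParametricEuler.residue (ParametricEuler.kernelFun p r) β) = 0 := by
  have hs1 := ParametricEuler.summable_genHarmonic_mul_ratEval hp hr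
    ((-1) ^ p * ParametricEuler.zetaNat p)
  have hs2 := ParametricEuler.summable_genHarmonic_mul_ratEval_neg hp hr (ParametricEuler.zetaNat p)
  have hs3 := ParametricEuler.summable_iteratedDeriv_ratEval hr
  refine ⟨hs1, hs2, fun k _ => hs3 _, ?_⟩
  have hres : ∀ {c a : ℂ}, ParametricEuler.HasRes (ParametricEuler.kernelFun p r) c a →
      ParametricEuler.residue (ParametricEuler.kernelFun p r) c = a := fun {c a} h =>
    ParametricEuler.residue_eq_of_hasRes
      (ParametricEuler.eventually_differentiableAt_kernelFun hp r c) h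
  -- The partial sums are shifted by one because the circle of radius `N + 1/2` encloses the `N+1`
  -- integers `0, …, N` but only `N` negative ones.
  have hpos := (((hasSum_sum fun k (_ : k ∈ Finset.range (p / 2 + 1)) =>
    (((hs3 (p - 2 * k)).hasSum.div_const ((p - 2 * k).factorial : ℂ)).mul_left
      (ParametricEuler.zetaNat (2 * k)))).mul_left (-2)).add hs1.hasSum).tendsto_sum_nat.comp
        (tendsto_add_atTop_nat 1)
  have hneg := (hs2.hasSum.mul_left ((-1) ^ p)).tendsto_sum_nat
  have hint0 := (ParametricEuler.tendsto_circleIntegral_kernelFun hp hr).const_mul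
    (2 * Real.pi * Complex.I)⁻¹
  rw [mul_zero] at hint0
  -- The sums of enclosed residues converge to the total of the series and the residues at the poles
  -- of `r`. For large `N` they equal the normalised contour integrals, which tend to `0`.
  have htot := tendsto_nhds_unique
    ((tendsto_const_nhds (x := ∑ β ∈ ParametricEuler.poles r,
      ParametricEuler.residue (ParametricEuler.kernelFun p r) β)).add (hpos.add hneg))
    (hint0.congr' ?_)
  · rw [← htot, Finset.mul_sum, Finset.mul_sum]
    have : ∀ k, 2 * (1 / ((p - 2 * k).factorial : ℂ) * ParametricEuler.zetaNat (2 * k)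
            * ∑' n : ℕ, iteratedDeriv (p - 2 * k) (ParametricEuler.ratEval r) (n : ℂ)) =
        -(-2 * (ParametricEuler.zetaNat (2 * k) *
          ((∑' n : ℕ, iteratedDeriv (p - 2 * k) (ParametricEuler.ratEval r) (n : ℂ)) /
            (p - 2 * k).factorial))) := fun k => by ring
    simp only [this, Finset.sum_neg_distrib]
    ring
  · obtain ⟨A, R₀, -, -, hpoles, -⟩ := ParametricEuler.exists_norm_ratEval_le hr
    filter_upwards [eventually_ge_atTop ⌈R₀⌉₊] with N hN
    have hN' : R₀ ≤ N := Nat.ceil_le.1 hN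
    rw [ParametricEuler.circleIntegral_eq_sum_residues (ParametricEuler.enclosedPoles r N) _
      (ParametricEuler.residue (ParametricEuler.kernelFun p r)) (by positivity)
      (fun c hc => by
        simpa using ParametricEuler.norm_lt_of_mem_enclosedPoles
          (fun β hβ => (hpoles β hβ).trans_le hN') hc)
      (fun z hz hzT => ParametricEuler.differentiableAt_kernelFun hp (fun n hn => hzT ?_)
        fun h => hzT (Finset.mem_union_left _ h))
      (fun c hc => ParametricEuler.hasRes_residue_kernelFun hp hint hc),
      inv_mul_cancel_left₀ Complex.two_pi_I_ne_zero,
      ParametricEuler.sum_enclosedPoles hint]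
    · congr 1
      congr 1
      · exact Finset.sum_congr rfl fun n _ =>
          hres (ParametricEuler.hasRes_kernelFun_natCast hp n (by exact_mod_cast hint n))
      · exact Finset.sum_congr rfl fun n _ =>
          hres (ParametricEuler.hasRes_kernelFun_neg hp n (by exact_mod_cast hint (-(n + 1))))
    · rw [hn]
      refine ParametricEuler.intCast_mem_enclosedPoles r ?_
      rw [hn, mem_closedBall_zero_iff, Complex.norm_intCast, ← Int.cast_abs] at hz
      by_contra hlt
      have : (N : ℝ) + 1 ≤ ((|n| : ℤ) : ℝ) := by exact_mod_cast not_le.1 hlt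
      linarith
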